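/- **Setting.** Let $\mathbb A$ be a nonempty finite set of actions, let $\Theta$ be a nonempty compact subset of a Euclidean space (parameters) and let $\mathbb Y$ be a Borel subset of a Euclidean space (consequences). The true law of the consequence of action $a$ is the probability measure $Q(\cdot\mid a)$; the agent's (possibly misspecified) model is a family of probability measures $Q_\theta(\cdot\mid a)$, $\theta\in\Theta$; the payoff is $\pi:\mathbb A\times\mathbb Y\to\mathbb R$. Assume: * there is a $\sigma$-finite measure $\nu$ on $\mathbb Y$ such that $Q(\cdot\mid a)$ and $Q_\theta(\cdot\mid a)$ have measurable finite densities $q(\cdot\mid a)$ and $q_\theta(\cdot\mid a)$ with respect to $\nu$, and for $\nu$-a.e. $y$ the map $\theta\mapsto q_\theta(y\mid a)$ is continuous for every $a$; * there are measurable $M:\mathbb Y\to[1,\infty)$ and $r,h:\mathbb Y\to[0,\infty)$ such that, for all $(\theta,a)$ and $\nu$-a.e. $y$, $q_\theta(y\mid a)M(y)^{-1}\le q(y\mid a)\le q_\theta(y\mid a)M(y)$ and $q(y\mid a)\le r(y)$, with $\int M r\,d\nu<\infty$; for every $a$, $\pi(a,\cdot)$ is $\nu$-a.e. measurable and $|\pi(a,y)|\le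 h(y)$ for $\nu$-a.e. $y$, with $\int h M r\,d\nu<\infty$. Put $U(a,\theta)=\int\pi(a,y)\,Q_\theta(dy\mid a)$ and $K(\theta,a)=\mathrm{KL}\big(Q(\cdot\mid a)\,\|\,Q_\theta(\cdot\mid a)\big)$, and for $\sigma\in\Delta\mathbb A$ put $\Theta^{\mathrm m}(\sigma)=\arg\min_{\theta\in\Theta}\sum_a\sigma(a)K(\theta,a)$. Let $\lambda$ be a probability measure on $\mathbb R^{\mathbb A}$ with a continuous density with respect to Lebesgue measure (the law of the payoff shocks). For a Borel probability measure $\mu$ on $\Theta$ ($\mu\in\Delta\Theta$) define the intended mixed action $$\sigma^{\mathrm I}(\mu)(a)=\lambda\Big\{e\in\mathbb R^{\mathbb A}:\ a\in\arg\max_{a'\in\mathbb A}\Big(\int_\Theta U(a',\theta)\,\mu(d\theta)+e(a')\Big)\Big\},\qquad a\in\mathbb A.$$ A distribution $\sigma\in\Delta\mathbb A$ is a *Berk–Nash equilibrium in intended strategies* if there is $\mu\in\Delta\Theta$ with $\operatorname{supp}\mu\subseteq\Theta^{\mathrm m}(\sigma)$ and $\sigma=\sigma^{\mathrm I}(\mu)$.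 **Dynamics.** Let $\mu_0\in\Delta\Theta$ be a prior with full support. On a probability space $(\Omega,\mathbf P)$, in each period $t=0,1,2,\dots$: a shock vector $\eta_t$ with law $\lambda$ is drawn independently of the history $(\eta_s,a_s,y_s)_{s<t}$; the agent chooses, almost surely, an action $a_t\in\arg\max_{a}\big(\int_\Theta U(a,\theta)\,\mu_t(d\theta)+\eta_t(a)\big)$; a consequence $y_t$ is drawn, with conditional law $Q(\cdot\mid a_t)$ given the history, $\eta_t$ and $a_t$; and the belief is updated by Bayes' rule, $\mu_{t+1}(B)=\int_B q_\theta(y_t\mid a_t)\,\mu_t(d\theta)\big/\int_\Theta q_\theta(y_t\mid a_t)\,\mu_t(d\theta)$. Let $\sigma^{\mathrm I}_t=\sigma^{\mathrm I}(\mu_t)$. **Proposition.** The map $\sigma^{\mathrm I}$ takes values in $\Delta\mathbb A$ and is continuous on $\Delta\Theta$ with the topology of weak convergence. Moreover, $\mathbf P$-almost surely, the following implication holds for every $\sigma\in\Delta\mathbb A$: if $\sigma^{\mathrm I}_t\to\sigma$ as $t\to\infty$, then $\sigma$ is a Berk–Nash equilibrium in intended strategies. -/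

import Mathlib

open MeasureTheory ProbabilityTheory Filter Topology
open scoped NNReal ENNReal

noncomputable section

namespace BerkNash

/-- The primitives of the single-agent problem, with actions `A`, parameters `Θ` and consequences
`Y`: a reference measure `ν`, the density `q(y ∣ a)` of the true consequence kernel, the densities
`q_θ(y ∣ a)` of the subjective model, and the per-period payoff `π(a, y)`. -/
structure Environment (A Θ Y : Type*) [MeasurableSpace Y] where
  ν : Measure Y
  q : A → Y → ℝ≥0
  qModel : Θ → A → Y → ℝ≥0
  payoff : A → Y → ℝ

namespace Environment

variable {A Θ Y : Type*} [MeasurableSpace Y]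

/-- The true consequence kernel `Q(· ∣ a)`. -/
def trueLaw (E : Environment A Θ Y) (a : A) : Measure Y :=
  E.ν.withDensity fun y => (E.q a y : ℝ≥0∞)

/-- The model kernel `Q_θ(· ∣ a)`. -/
def modelLaw (E : Environment A Θ Y) (θ : Θ) (a : A) : Measure Y :=
  E.ν.withDensity fun y => (E.qModel θ a y : ℝ≥0∞)

/-- The standing assumptions, for a finite (discrete) action set: `Q(· ∣ a)` and `Q_θ(· ∣ a)` are
probability measures with densities with respect to a σ-finite `ν`; almost every `θ ↦ q_θ(y ∣ a)`
is continuous (continuity in `a` is automatic); the likelihood-ratio envelope; and the payoff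
envelope. -/
structure Standing (E : Environment A Θ Y) [TopologicalSpace Θ] : Prop where
  sigmaFinite : SigmaFinite E.ν
  measurable_q : ∀ a, Measurable (E.q a)
  measurable_qModel : ∀ θ a, Measurable (E.qModel θ a)
  isProbability_trueLaw : ∀ a, IsProbabilityMeasure (E.trueLaw a)
  isProbability_modelLaw : ∀ θ a, IsProbabilityMeasure (E.modelLaw θ a)
  continuous_qModel : ∀ᵐ y ∂E.ν, ∀ a, Continuous fun θ => E.qModel θ a y
  aemeasurable_payoff : ∀ a, AEMeasurable (E.payoff a) E.ν
  envelope : ∃ M r h : Y → ℝ≥0, Measurable M ∧ Measurable r ∧ Measurable h ∧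
    (∀ y, 1 ≤ M y) ∧
    (∀ θ a, ∀ᵐ y ∂E.ν, E.qModel θ a y * (M y)⁻¹ ≤ E.q a y ∧
      E.q a y ≤ E.qModel θ a y * M y ∧ E.q a y ≤ r y) ∧
    ∫⁻ y, (M y : ℝ≥0∞) * r y ∂E.ν < ∞ ∧
    (∀ a, ∀ᵐ y ∂E.ν, |E.payoff a y| ≤ h y) ∧
    ∫⁻ y, (h y : ℝ≥0∞) * M y * r y ∂E.ν < ∞

/-- The perceived expected payoff `U(a, θ) = ∫ π(a, y) Q_θ(dy ∣ a)`. -/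
def U (E : Environment A Θ Y) (a : A) (θ : Θ) : ℝ :=
  ∫ y, E.payoff a y ∂E.modelLaw θ a

/-- The Kullback–Leibler divergence `K(θ, a) = KL(Q(· ∣ a) ‖ Q_θ(· ∣ a))`. -/
def K (E : Environment A Θ Y) (θ : Θ) (a : A) : ℝ≥0∞ :=
  InformationTheory.klDiv (E.trueLaw a) (E.modelLaw θ a)

/-- The set `Θᵐ(σ)` of minimizers over `θ` of `∑ₐ σ(a) K(θ, a)`. -/
def klMinimizers [Fintype A] (E : Environment A Θ Y) (σ : A → ℝ) : Set Θ :=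
  {θ | ∀ θ', ∑ a, ENNReal.ofReal (σ a) * E.K θ a ≤ ∑ a, ENNReal.ofReal (σ a) * E.K θ' a}

/-- The actions that maximize `a ↦ ∫ U(a, θ) μ(dθ) + e(a)`, for belief `μ` and realized payoff
shocks `e`. -/
def perturbedArgmax [MeasurableSpace Θ] (E : Environment A Θ Y) (μ : Measure Θ) (e : A → ℝ) :
    Set A :=
  {a | ∀ a', (∫ θ, E.U a' θ ∂μ) + e a' ≤ (∫ θ, E.U a θ ∂μ) + e a}

/-- The intended mixed action `σᴵ(μ)`: the choice probabilities at belief `μ`, when `shock` is the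
law of the payoff shocks. -/
def intended [MeasurableSpace Θ] (E : Environment A Θ Y) (shock : Measure (A → ℝ))
    (μ : Measure Θ) (a : A) : ℝ :=
  shock.real {e | a ∈ E.perturbedArgmax μ e}

/-- `σ` is a Berk–Nash equilibrium in intended strategies. -/
def IsBerkNashIntended [Fintype A] [TopologicalSpace Θ] [MeasurableSpace Θ]
    (E : Environment A Θ Y) (shock : Measure (A → ℝ)) (σ : A → ℝ) : Prop :=
  σ ∈ stdSimplex ℝ A ∧
    ∃ μ : ProbabilityMeasure Θ,
      (μ : Measure Θ).support ⊆ E.klMinimizers σ ∧ σ = E.intended shock (μ : Measure Θ)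

/-- Bayes' rule: `B ↦ ∫_B q_θ(y ∣ a) μ(dθ) / ∫_Θ q_θ(y ∣ a) μ(dθ)`. -/
def bayesUpdate [MeasurableSpace Θ] (E : Environment A Θ Y) (μ : Measure Θ) (a : A) (y : Y) :
    Measure Θ :=
  (∫⁻ θ, (E.qModel θ a y : ℝ≥0∞) ∂μ)⁻¹ • μ.withDensity fun θ => (E.qModel θ a y : ℝ≥0∞)

/-- The belief at time `t` along a path of actions and consequences; at time `0` it is the
prior. -/
def posterior [MeasurableSpace Θ] (E : Environment A Θ Y) (prior : Measure Θ)
    (a : ℕ → A) (y : ℕ → Y) : ℕ → Measure Θ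
  | 0 => prior
  | t + 1 => E.bayesUpdate (E.posterior prior a y t) (a t) (y t)

/-- The history at the beginning of period `t`: shocks, actions and consequences of the periods
before `t`. -/
def history {Ω : Type*} (η : ℕ → Ω → A → ℝ) (act : ℕ → Ω → A) (y : ℕ → Ω → Y) (t : ℕ) (ω : Ω) :
    Fin t → (A → ℝ) × A × Y :=
  fun s => (η s ω, act s ω, y s ω)

/-- `(η, act, y)` is a realization, on a probability space `(Ω, P)`, of the learning dynamics with
perturbed payoffs. In every period `t`, a shock vector `η t` is drawn from `shock`, independently of
the history; the agent's action `act t` maximizes the perturbed expected payoff under the current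
posterior; and the consequence `y t` is drawn from the true kernel, that is, `Q(· ∣ act t)` is its
conditional law given the history and the current shock and action. -/
structure IsLearningDynamics [MeasurableSpace A] [MeasurableSpace Θ] (E : Environment A Θ Y)
    (prior : Measure Θ) (shock : Measure (A → ℝ)) {Ω : Type*} [MeasurableSpace Ω] (P : Measure Ω)
    (η : ℕ → Ω → A → ℝ) (act : ℕ → Ω → A) (y : ℕ → Ω → Y) : Prop where
  measurable_shock : ∀ t, Measurable (η t)
  measurable_act : ∀ t, Measurable (act t)
  measurable_y : ∀ t, Measurable (y t)
  shock_law : ∀ t, P.map (η t) = shock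
  shock_indep : ∀ t, IndepFun (η t) (history η act y t) P
  optimal : ∀ t, ∀ᵐ ω ∂P,
    act t ω ∈ E.perturbedArgmax (E.posterior prior (fun s => act s ω) (fun s => y s ω) t) (η t ω)
  consequence_law : ∀ t, ∀ B : Set Y, MeasurableSet B →
    P⟦y t ⁻¹' B | MeasurableSpace.comap (fun ω => (history η act y t ω, η t ω, act t ω))
      inferInstance⟧ =ᵐ[P] fun ω => (E.trueLaw (act t ω)).real B

end Environment

end BerkNash

end

/-! After `t` periods the belief is the prior reweighted by the exponential of the sum of the
log-likelihood ratios `log (q_θ / q)` at the observed pairs `(a_s, y_s)`. Suppose that the intended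
actions converge to `σ`. Two strong laws for martingale differences then determine the average of
this exponent. Given the history, the action has law `σᴵ(μ_t)`, because ties between perturbed
payoffs are null (`measureReal_history_act`); hence the empirical frequencies of the actions tend to
`σ`. Given the action, the consequence has law `Q(· ∣ a)`; hence averages of `f (a_s, y_s)` tend to
`∑ₐ σ(a) ∫ f(a, ·) dQ(· ∣ a)` (`tendsto_average_of_tendsto_frequency`). For the log-likelihood ratio
this limit is `-∑ₐ σ(a) K(θ, a)`.

The strong laws are applied only to countably many functions: the ratios at a dense sequence of
parameters, and the oscillations in `θ` at scales `1/(k+1)`, whose expectations vanish with the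
scale. This makes the convergence locally uniform in `θ`, on one almost sure event that serves all
`σ`. If `θ` has a larger weighted divergence than some `θ'`, the exponent near `θ` falls below the
exponent near `θ'` by an amount linear in `t`; the prior charges every neighbourhood of `θ'`, so the
belief near `θ` vanishes (`exists_open_tendsto_tilted_zero`).

The beliefs themselves need not converge, but they have a cluster point `μ` by compactness. Its
support contains only minimizers, and `σ = σᴵ(μ)` by continuity of `σᴵ`
(`isBerkNashIntended_of_tendsto`). -/

noncomputable section

namespace BerkNash

/-! ### Strong law for martingale differences. -/

section MartingaleDifference

theorem sum_range_succ_mul_sub (S : ℕ → ℝ) (n : ℕ) :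
    ∑ k ∈ Finset.range n, ((k : ℝ) + 1) * (S (k + 1) - S k)
      = n * S n - ∑ k ∈ Finset.range n, S k := by
  induction n with
  | zero => simp
  | succ n ih => rw [Finset.sum_range_succ, ih, Finset.sum_range_succ]; push_cast; ring

/-- Kronecker's lemma with weights `1, 2, 3, …`. -/
theorem tendsto_average_zero_of_tendsto_sum_div {d : ℕ → ℝ} {c : ℝ}
    (h : Tendsto (fun n => ∑ k ∈ Finset.range n, d k / ((k : ℝ) + 1)) atTop (𝓝 c)) :
    Tendsto (fun n : ℕ => (n : ℝ)⁻¹ * ∑ k ∈ Finset.range n, d k) atTop (𝓝 0) := by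
  set S : ℕ → ℝ := fun n => ∑ k ∈ Finset.range n, d k / ((k : ℝ) + 1) with hS
  have hd : ∀ k, d k = ((k : ℝ) + 1) * (S (k + 1) - S k) := by
    intro k
    have : (k : ℝ) + 1 ≠ 0 := by positivity
    simp only [hS, Finset.sum_range_succ, add_sub_cancel_left]
    field_simp
  have hlim := h.sub h.cesaro
  rw [sub_self] at hlim
  refine hlim.congr' ?_
  filter_upwards [eventually_gt_atTop 0] with n hn
  have hn' : (n : ℝ) ≠ 0 := by positivity
  rw [Finset.sum_congr rfl fun k _ => hd k, sum_range_succ_mul_sub, mul_sub, inv_mul_cancel_left₀ hn']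

variable {Ω : Type*} {mΩ : MeasurableSpace Ω} {P : Measure Ω}

/-- The hypothesis on `Z` says that its conditional expectation given `m` vanishes, and `X` can be
pulled out of that expectation. This is the orthogonality of martingale increments. -/
theorem integral_mul_eq_zero_of_setIntegral_eq_zero [IsFiniteMeasure P] {m : MeasurableSpace Ω}
    (hm : m ≤ mΩ) {X Z : Ω → ℝ} (hX : StronglyMeasurable[m] X) (hX2 : MemLp X 2 P)
    (hZ2 : MemLp Z 2 P) (hZ : ∀ s, MeasurableSet[m] s → ∫ ω in s, Z ω ∂P = 0) :
    ∫ ω, X ω * Z ω ∂P = 0 := by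
  have hZint : Integrable Z P := hZ2.integrable one_le_two
  have h0 : (0 : Ω → ℝ) =ᵐ[P] P[Z | m] := by
    refine ae_eq_condExp_of_forall_setIntegral_eq hm hZint (fun _ _ _ => integrableOn_zero)
      (fun s hs _ => ?_) aestronglyMeasurable_zero
    simp [hZ s hs]
  have hXZ : Integrable (X * Z) P := hX2.integrable_mul hZ2
  have h1 : P[X * Z | m] =ᵐ[P] X * P[Z | m] := condExp_mul_of_stronglyMeasurable_left hX hXZ hZint
  change ∫ ω, (X * Z) ω ∂P = 0
  rw [← integral_condExp hm, integral_congr_ae h1]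
  refine integral_eq_zero_of_ae ?_
  filter_upwards [h0] with ω hω
  simp [← hω]

/-- The strong law of large numbers for martingale differences bounded in `L²`. -/
theorem ae_tendsto_average_zero_of_martingale_difference [IsProbabilityMeasure P]
    (ℱ : Filtration ℕ mΩ) {D : ℕ → Ω → ℝ} (hmeas : ∀ n, StronglyMeasurable[ℱ (n + 1)] (D n))
    (hL2 : ∀ n, MemLp (D n) 2 P)
    (hzero : ∀ n s, MeasurableSet[ℱ n] s → ∫ ω in s, D n ω ∂P = 0)
    {C : ℝ} (hC : ∀ n, ∫ ω, D n ω ^ 2 ∂P ≤ C) :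
    ∀ᵐ ω ∂P, Tendsto (fun n : ℕ => (n : ℝ)⁻¹ * ∑ k ∈ Finset.range n, D k ω) atTop (𝓝 0) := by
  -- By Kronecker's lemma it suffices that the martingale with increments `D k / (k + 1)` converges
  -- almost surely.
  set X : ℕ → Ω → ℝ := fun k ω => D k ω / ((k : ℝ) + 1) with hX
  set M : ℕ → Ω → ℝ := fun n ω => ∑ k ∈ Finset.range n, X k ω with hM
  have hXL2 : ∀ n, MemLp (X n) 2 P := by
    intro n
    simp only [hX, div_eq_mul_inv]
    exact (hL2 n).mul_const _
  have hML2 : ∀ n, MemLp (M n) 2 P := fun n => memLp_finsetSum _ fun k _ => hXL2 k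
  have hMmeas : ∀ n, StronglyMeasurable[ℱ n] (M n) := by
    intro n
    refine Finset.stronglyMeasurable_fun_sum _ fun k hk => ?_
    simp only [hX, div_eq_mul_inv]
    exact ((hmeas k).mono (ℱ.mono (Finset.mem_range.1 hk))).mul_const _
  have hXzero : ∀ n s, MeasurableSet[ℱ n] s → ∫ ω in s, X n ω ∂P = 0 := by
    intro n s hs
    simp [hX, integral_div, hzero n s hs]
  have hsucc : ∀ n, M (n + 1) = M n + X n := by
    intro n; ext ω; simp [hM, Finset.sum_range_succ]
  have hMint : ∀ n, Integrable (M n) P := fun n => (hML2 n).integrable one_le_two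
  have hXint : ∀ n, Integrable (X n) P := fun n => (hXL2 n).integrable one_le_two
  have hsub : Submartingale M ℱ P := by
    refine submartingale_of_setIntegral_le_succ hMmeas hMint fun n s hs => ?_
    rw [hsucc]
    simp only [Pi.add_apply]
    rw [integral_add (hMint n).integrableOn (hXint n).integrableOn, hXzero n s hs, add_zero]
  have hC0 : 0 ≤ C := (integral_nonneg fun ω => sq_nonneg (D 0 ω)).trans (hC 0)
  have hsummable : Summable fun k : ℕ => C / ((k : ℝ) + 1) ^ 2 := by
    have := (summable_nat_add_iff 1).2 (Real.summable_one_div_nat_pow.2 one_lt_two)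
    simpa [div_eq_mul_inv] using this.mul_left C
  -- The increments are orthogonal, so second moments add.
  have hsq : ∀ n, ∫ ω, M n ω ^ 2 ∂P ≤ ∑ k ∈ Finset.range n, C / ((k : ℝ) + 1) ^ 2 := by
    intro n
    induction n with
    | zero => simp [hM]
    | succ n ih =>
      have hexp : ∀ ω, M (n + 1) ω ^ 2 = M n ω ^ 2 + 2 * (M n ω * X n ω) + X n ω ^ 2 := by
        intro ω; rw [hsucc, Pi.add_apply]; ring
      have hMX : Integrable (fun ω => M n ω * X n ω) P := (hML2 n).integrable_mul (hXL2 n)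
      have hadd : Integrable (fun ω => M n ω ^ 2 + 2 * (M n ω * X n ω)) P :=
        (hML2 n).integrable_sq.add (hMX.const_mul 2)
      simp_rw [hexp]
      rw [integral_add hadd (hXL2 n).integrable_sq,
        integral_add (hML2 n).integrable_sq (hMX.const_mul 2), integral_const_mul,
        integral_mul_eq_zero_of_setIntegral_eq_zero (ℱ.le n) (hMmeas n) (hML2 n) (hXL2 n)
          (hXzero n), mul_zero, add_zero, Finset.sum_range_succ]
      refine add_le_add ih ?_
      simp only [hX, div_pow]
      rw [integral_div]
      gcongr
      exact hC n
  set T := ∑' k : ℕ, C / ((k : ℝ) + 1) ^ 2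
  -- Doob's convergence theorem asks for an `L¹` bound; `|x| ≤ 1 + x²` derives it from the `L²`
  -- bound.
  have hbdd : ∀ n, eLpNorm (M n) 1 P ≤ ((1 + T).toNNReal : ℝ≥0∞) := by
    intro n
    rw [eLpNorm_one_eq_lintegral_enorm, ← ofReal_integral_norm_eq_lintegral_enorm (hMint n)]
    refine ENNReal.ofReal_le_ofReal ?_
    have : ∀ ω, ‖M n ω‖ ≤ 1 + M n ω ^ 2 := by
      intro ω
      rw [Real.norm_eq_abs, ← sq_abs]
      nlinarith [sq_nonneg (|M n ω| - 1), abs_nonneg (M n ω)]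
    calc ∫ ω, ‖M n ω‖ ∂P ≤ ∫ ω, (1 + M n ω ^ 2) ∂P :=
          integral_mono (hMint n).norm ((integrable_const 1).add (hML2 n).integrable_sq) this
      _ = 1 + ∫ ω, M n ω ^ 2 ∂P := by
          rw [integral_add (integrable_const 1) (hML2 n).integrable_sq]; simp
      _ ≤ 1 + T := by
          gcongr
          exact (hsq n).trans (hsummable.sum_le_tsum _ fun k _ => by positivity)
  filter_upwards [hsub.ae_tendsto_limitProcess hbdd] with ω hω
  exact tendsto_average_zero_of_tendsto_sum_div hω

end MartingaleDifference

/-! ### Choice probabilities under payoff shocks. -/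

section RandomUtility

variable {A : Type*}

/-- The shocks for which `a` maximizes the perturbed utility `u + e`. -/
def choiceRegion (u : A → ℝ) (a : A) : Set (A → ℝ) :=
  {e | ∀ a', u a' + e a' ≤ u a + e a}

/-- The probability that `a` maximizes `u + e` for `e` drawn from `shock`. -/
def choiceProb (shock : Measure (A → ℝ)) (u : A → ℝ) (a : A) : ℝ :=
  shock.real (choiceRegion u a)

theorem measurableSet_choiceRegion [Countable A] (u : A → ℝ) (a : A) :
    MeasurableSet (choiceRegion u a) := by
  simp only [choiceRegion, Set.ofPred_forall]
  exact MeasurableSet.iInter fun a' => measurableSet_le (by fun_prop) (by fun_prop)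

/-- The ties form an affine hyperplane, and a proper affine subspace is Lebesgue null. -/
theorem volume_tie_eq_zero [Fintype A] (u : A → ℝ) {a b : A} (hab : a ≠ b) :
    volume {e : A → ℝ | u a + e a = u b + e b} = 0 := by
  classical
  let L : (A → ℝ) →ₗ[ℝ] ℝ := LinearMap.proj (R := ℝ) (φ := fun _ : A => ℝ) a - LinearMap.proj b
  let s : AffineSubspace ℝ (A → ℝ) :=
    AffineSubspace.mk' (Pi.single a (u b - u a)) (LinearMap.ker L)
  have hmem : ∀ e : A → ℝ, e ∈ s ↔ u a + e a = u b + e b := by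
    intro e
    simp only [s, AffineSubspace.mem_mk', LinearMap.mem_ker, L, vsub_eq_sub, LinearMap.sub_apply,
      LinearMap.proj_apply, Pi.sub_apply, Pi.single_eq_same, Pi.single_eq_of_ne hab.symm]
    constructor <;> intro h <;> linarith
  have hs : s ≠ ⊤ := by
    intro h
    have h1 : (Pi.single a (u b - u a + 1) : A → ℝ) ∈ s := h ▸ AffineSubspace.mem_top ..
    rw [hmem, Pi.single_eq_same, Pi.single_eq_of_ne hab.symm] at h1
    linarith
  have : {e : A → ℝ | u a + e a = u b + e b} = (s : Set (A → ℝ)) := by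
    ext e; exact (hmem e).symm
  rw [this]
  exact Measure.addHaar_affineSubspace volume s hs

variable {shock : Measure (A → ℝ)}

theorem ae_no_tie [Fintype A] (hac : shock ≪ volume) (u : A → ℝ) :
    ∀ᵐ e ∂shock, ∀ a b, a ≠ b → u a + e a ≠ u b + e b := by
  rw [ae_all_iff]; intro a
  rw [ae_all_iff]; intro b
  by_cases hab : a = b
  · simp [hab]
  · have h := hac (volume_tie_eq_zero u hab)
    rw [measure_eq_zero_iff_ae_notMem] at h
    filter_upwards [h] with e he _ using he

/-- The choice regions cover the space, since a finite family has a maximum, and they overlap only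
in ties. -/
theorem choiceProb_mem_stdSimplex [Fintype A] [Nonempty A] [IsProbabilityMeasure shock]
    (hac : shock ≪ volume) (u : A → ℝ) :
    choiceProb shock u ∈ stdSimplex ℝ A := by
  refine ⟨fun a => measureReal_nonneg, ?_⟩
  have hdisj : Pairwise (Function.onFun (AEDisjoint shock) (choiceRegion u)) := by
    intro a b hab
    change shock (choiceRegion u a ∩ choiceRegion u b) = 0
    refine measure_mono_null (fun e he => ?_) (hac (volume_tie_eq_zero u hab))
    exact le_antisymm (he.2 a) (he.1 b)
  have hunion : ⋃ a, choiceRegion u a = Set.univ := by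
    refine Set.eq_univ_of_forall fun e => ?_
    obtain ⟨a, ha⟩ := Finite.exists_max fun a => u a + e a
    exact Set.mem_iUnion.2 ⟨a, ha⟩
  have h := measure_iUnion₀ hdisj fun a => (measurableSet_choiceRegion u a).nullMeasurableSet
  rw [hunion, measure_univ, tsum_fintype] at h
  simp only [choiceProb, measureReal_def]
  rw [← ENNReal.toReal_sum fun a _ => measure_ne_top _ _, ← h, ENNReal.toReal_one]

/-- For a shock without ties at `u` every comparison is strict, so it persists for utilities near
`u`. The indicator of the choice region is thus almost surely locally constant at `u`, and the
measures converge. -/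
theorem continuous_choiceProb [Fintype A] [IsProbabilityMeasure shock] (hac : shock ≪ volume) :
    Continuous (choiceProb shock) := by
  refine continuous_pi fun a => continuous_iff_continuousAt.2 fun u => ?_
  refine (ENNReal.tendsto_toReal (measure_ne_top _ _)).comp
    (tendsto_measure_of_ae_tendsto_indicator_of_isFiniteMeasure (𝓝 u)
      (measurableSet_choiceRegion u a) (fun v => measurableSet_choiceRegion v a) ?_)
  filter_upwards [ae_no_tie hac u] with e he
  have hcont : ∀ b, Tendsto (fun v : A → ℝ => v b + e b) (𝓝 u) (𝓝 (u b + e b)) := fun b =>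
    ((continuous_apply b).add continuous_const).tendsto u
  by_cases hmem : e ∈ choiceRegion u a
  · have hev : ∀ᶠ v in 𝓝 u, ∀ b, v b + e b ≤ v a + e a := by
      rw [eventually_all]
      intro b
      rcases eq_or_ne b a with rfl | hb
      · exact Eventually.of_forall fun _ => le_rfl
      · filter_upwards [(hcont b).eventually_lt (hcont a) ((hmem b).lt_of_ne (he b a hb))]
          with v hv using hv.le
    filter_upwards [hev] with v hv
    exact iff_of_true hv hmem
  · have hmem' := hmem
    simp only [choiceRegion, Set.mem_ofPred_eq, not_forall, not_le] at hmem'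
    obtain ⟨b, hb⟩ := hmem'
    filter_upwards [(hcont a).eventually_lt (hcont b) hb] with v hv
    exact iff_of_false (fun h => (h b).not_gt hv) hmem

namespace Environment

variable {Θ Y : Type*} [MeasurableSpace Y] [MeasurableSpace Θ]

theorem perturbedArgmax_iff (E : Environment A Θ Y) (μ : Measure Θ) (e : A → ℝ) (a : A) :
    a ∈ E.perturbedArgmax μ e ↔ e ∈ choiceRegion (fun a => ∫ θ, E.U a θ ∂μ) a :=
  Iff.rfl

theorem intended_eq_choiceProb (E : Environment A Θ Y) (μ : Measure Θ) :
    E.intended shock μ = choiceProb shock fun a => ∫ θ, E.U a θ ∂μ :=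
  rfl

end Environment

end RandomUtility

/-! ### A regular version of the log-likelihood ratio. -/

namespace Environment

variable {A Θ Y : Type*} [MeasurableSpace Y]

/-- `g` is an everywhere regular version of the log-likelihood ratio `log (q_θ(y ∣ a) / q(y ∣ a))`,
dominated by `b`. -/
structure IsLogLikelihood [MeasurableSpace A] [TopologicalSpace Θ] (E : Environment A Θ Y)
    (g : Θ → A × Y → ℝ) (b : Y → ℝ) : Prop where
  continuous : ∀ x, Continuous fun θ => g θ x
  measurable : ∀ θ, Measurable (g θ)
  measurable_bound : Measurable b
  abs_le_bound : ∀ θ a y, |g θ (a, y)| ≤ b y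
  memLp_bound : ∀ a, MemLp b 2 (E.trueLaw a)
  integrable_payoff : ∀ a, Integrable (fun y => E.payoff a y * Real.exp (b y)) (E.trueLaw a)
  qModel_eq : ∀ᵐ y ∂E.ν, ∀ a θ, (E.qModel θ a y : ℝ) = E.q a y * Real.exp (g θ (a, y))

theorem abs_log_div_le_log {p q M : ℝ} (hq : 0 < q) (hp : 0 < p) (hM : 1 ≤ M) (h1 : p * M⁻¹ ≤ q)
    (h2 : q ≤ p * M) : |Real.log (p / q)| ≤ Real.log M := by
  have hM0 : 0 < M := by positivity
  rw [abs_le, ← Real.log_inv]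
  constructor
  · refine Real.log_le_log (by positivity) ?_
    rw [le_div_iff₀ hq, inv_mul_le_iff₀ hM0]
    linarith
  · refine Real.log_le_log (by positivity) ?_
    rw [div_le_iff₀ hq]
    rwa [← div_eq_mul_inv, div_le_iff₀ hM0, mul_comm] at h1

/-- `log x = 2 log √x ≤ 2 √x`. Integrability of the envelope `M` therefore gives square
integrability of `log M`, as the `L²` strong law needs. -/
theorem log_sq_le {x : ℝ} (hx : 1 ≤ x) : Real.log x ^ 2 ≤ 4 * x := by
  have h0 : 0 ≤ Real.log x := Real.log_nonneg hx
  have h1 : Real.log x ≤ 2 * √x := by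
    have := Real.log_le_self (Real.sqrt_nonneg x)
    rw [Real.log_sqrt (by positivity)] at this
    linarith
  calc Real.log x ^ 2 ≤ (2 * √x) ^ 2 := by gcongr
    _ = 4 * x := by rw [mul_pow, Real.sq_sqrt (by positivity)]; norm_num

/-- The bound is `b = log M`. It is square integrable because `q ≤ r` and `M r` is integrable, and
`exp b = M` turns the payoff condition into integrability of `h M r`. -/
theorem exists_isLogLikelihood [Finite A] [MeasurableSpace A] [MeasurableSingletonClass A]
    [TopologicalSpace Θ] [TopologicalSpace.SeparableSpace Θ] [Nonempty Θ]
    {E : Environment A Θ Y} (hE : E.Standing) : ∃ g b, E.IsLogLikelihood g b := by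
  obtain ⟨M, r, h, hM, hr, hh, hM1, henv, hMr, hpay, hhMr⟩ := hE.envelope
  have : SigmaFinite E.ν := hE.sigmaFinite
  have hgood : ∀ᵐ y ∂E.ν, ∀ a, (Continuous fun θ => E.qModel θ a y) ∧ ∀ θ,
      E.qModel θ a y * (M y)⁻¹ ≤ E.q a y ∧ E.q a y ≤ E.qModel θ a y * M y ∧ E.q a y ≤ r y := by
    -- The null set in the envelope condition depends on `θ`. One null set suffices for a dense
    -- sequence, and continuity in `θ` extends the inequalities to all parameters.
    have h1 : ∀ᵐ y ∂E.ν, ∀ a, ∀ n : ℕ, E.qModel (TopologicalSpace.denseSeq Θ n) a y * (M y)⁻¹ ≤ E.q a y ∧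
        E.q a y ≤ E.qModel (TopologicalSpace.denseSeq Θ n) a y * M y ∧ E.q a y ≤ r y := by
      rw [ae_all_iff]; intro a; rw [ae_all_iff]; intro n; exact henv _ a
    filter_upwards [hE.continuous_qModel, h1] with y hc hy a
    refine ⟨hc a, fun θ => ?_⟩
    refine (TopologicalSpace.denseRange_denseSeq Θ).induction_on θ ?_ (hy a)
    exact (isClosed_le ((hc a).mul continuous_const) continuous_const).inter
      ((isClosed_le continuous_const ((hc a).mul continuous_const)).inter
        (isClosed_le continuous_const continuous_const))
  obtain ⟨s, hs, hs_meas, hs_good⟩ := hgood.exists_measurable_mem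
  classical
  -- The value `0` off the good set keeps continuity, measurability and the bound valid at every
  -- point.
  let g : Θ → A × Y → ℝ := fun θ x =>
    if x.2 ∈ s ∧ E.q x.1 x.2 ≠ 0 then Real.log (E.qModel θ x.1 x.2 / E.q x.1 x.2) else 0
  have hpos : ∀ θ a y, y ∈ s → E.q a y ≠ 0 → E.qModel θ a y ≠ 0 := by
    intro θ a y hy hq h0
    have := ((hs_good y hy a).2 θ).2.1
    rw [h0, zero_mul] at this
    exact hq (le_antisymm this bot_le)
  have hq_meas : Measurable fun x : A × Y => E.q x.1 x.2 :=
    measurable_from_prod_countable_right hE.measurable_q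
  have hexp : ∀ y, Real.exp (Real.log (M y)) = M y := fun y =>
    Real.exp_log (lt_of_lt_of_le one_pos (by exact_mod_cast hM1 y))
  have hM1' : ∀ y, (1 : ℝ) ≤ M y := fun y => by exact_mod_cast hM1 y
  have hM_meas : Measurable fun y => (M y : ℝ) := hM.coe_nnreal_real
  have hac : ∀ a, E.trueLaw a ≪ E.ν := fun a => withDensity_absolutelyContinuous _ _
  have hlint : ∀ a (f : Y → ℝ≥0), Measurable f → ∫⁻ y, (f y : ℝ≥0∞) * r y ∂E.ν < ∞ →
      Integrable (fun y => (f y : ℝ)) (E.trueLaw a) := by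
    intro a f hf hfr
    refine ⟨hf.coe_nnreal_real.aestronglyMeasurable, ?_⟩
    rw [hasFiniteIntegral_iff_enorm]
    simp only [Real.enorm_eq_ofReal NNReal.zero_le_coe, ENNReal.ofReal_coe_nnreal]
    rw [trueLaw, lintegral_withDensity_eq_lintegral_mul _ (hE.measurable_q a).coe_nnreal_ennreal
      hf.coe_nnreal_ennreal]
    refine lt_of_le_of_lt (lintegral_mono_ae ?_) hfr
    filter_upwards [henv (Classical.arbitrary Θ) a] with y hy
    simp only [Pi.mul_apply]
    rw [mul_comm]
    gcongr
    exact_mod_cast hy.2.2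
  have hMint : ∀ a, Integrable (fun y => (M y : ℝ)) (E.trueLaw a) := fun a => hlint a M hM hMr
  refine ⟨g, fun y => Real.log (M y), ?_, ?_, hM_meas.log, ?_, ?_, ?_, ?_⟩
  · rintro ⟨a, y⟩
    by_cases hy : y ∈ s ∧ E.q a y ≠ 0
    · simp only [g, if_pos hy]
      have hc : Continuous fun θ => (E.qModel θ a y : ℝ) / E.q a y :=
        (NNReal.continuous_coe.comp (hs_good y hy.1 a).1).div_const _
      exact hc.log fun θ => div_ne_zero (by exact_mod_cast hpos θ a y hy.1 hy.2)
        (by exact_mod_cast hy.2)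
    · simp only [g, if_neg hy]
      exact continuous_const
  · intro θ
    have hqm_meas : Measurable fun x : A × Y => E.qModel θ x.1 x.2 :=
      measurable_from_prod_countable_right (hE.measurable_qModel θ)
    refine Measurable.ite ?_ (hqm_meas.coe_nnreal_real.div hq_meas.coe_nnreal_real).log
      measurable_const
    exact (measurable_snd hs_meas).inter
      (hq_meas (measurableSet_singleton (0 : ℝ≥0))).compl
  · intro θ a y
    by_cases hy : y ∈ s ∧ E.q a y ≠ 0
    · simp only [g, if_pos hy]
      have h1 := (hs_good y hy.1 a).2 θ
      refine abs_log_div_le_log (NNReal.coe_pos.2 (pos_iff_ne_zero.2 hy.2))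
        (NNReal.coe_pos.2 (pos_iff_ne_zero.2 (hpos θ a y hy.1 hy.2))) (hM1' y) ?_ ?_
      · exact_mod_cast h1.1
      · exact_mod_cast h1.2.1
    · simp only [g, if_neg hy, abs_zero]
      exact Real.log_nonneg (hM1' y)
  · intro a
    refine (memLp_two_iff_integrable_sq hM_meas.log.aestronglyMeasurable).2 ?_
    refine ((hMint a).const_mul 4).mono' (hM_meas.log.pow_const 2).aestronglyMeasurable ?_
    filter_upwards with y
    rw [Real.norm_of_nonneg (sq_nonneg _)]
    exact log_sq_le (hM1' y)
  · intro a
    simp only [hexp]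
    have hhM : Integrable (fun y => ((h y * M y : ℝ≥0) : ℝ)) (E.trueLaw a) := by
      refine hlint a _ (hh.mul hM) ?_
      simpa only [ENNReal.coe_mul] using hhMr
    refine hhM.mono' (((hE.aemeasurable_payoff a).mono_ac (hac a)).mul
      hM_meas.aemeasurable).aestronglyMeasurable ?_
    filter_upwards [(hac a).ae_le (hpay a)] with y hy
    rw [norm_mul, NNReal.coe_mul, Real.norm_eq_abs, Real.norm_of_nonneg (M y).coe_nonneg]
    gcongr
  · filter_upwards [hs] with y hy a θ
    -- Where `q` vanishes, the envelope forces `q_θ` to vanish too, so the identity holds whatever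
    -- the value of `g`.
    by_cases hq : E.q a y = 0
    · have := ((hs_good y hy a).2 θ).1
      rw [hq, ← div_eq_mul_inv] at this
      have h0 : E.qModel θ a y / M y = 0 := le_antisymm this bot_le
      rcases div_eq_zero_iff.1 h0 with h0 | h0
      · simp [hq, h0]
      · exact absurd (h0 ▸ hM1 y) (by simp)
    · simp only [g, if_pos (And.intro hy hq)]
      have hq' : (0 : ℝ) < E.q a y := NNReal.coe_pos.2 (pos_iff_ne_zero.2 hq)
      have hp' : (0 : ℝ) < E.qModel θ a y :=
        NNReal.coe_pos.2 (pos_iff_ne_zero.2 (hpos θ a y hy hq))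
      rw [Real.exp_log (by positivity)]
      field_simp

end Environment

/-! ### Divergence as expected log-likelihood loss. -/

namespace Environment

variable {A Θ Y : Type*} [MeasurableSpace Y]

/-- The expected log-likelihood loss `-∫ g_θ(a, y) Q(dy ∣ a)`. -/
def loss (E : Environment A Θ Y) (g : Θ → A × Y → ℝ) (θ : Θ) (a : A) : ℝ :=
  -∫ y, g θ (a, y) ∂E.trueLaw a

namespace IsLogLikelihood

variable [MeasurableSpace A] [TopologicalSpace Θ] {E : Environment A Θ Y}
  {g : Θ → A × Y → ℝ} {b : Y → ℝ}

theorem measurable_section (hg : E.IsLogLikelihood g b) (θ : Θ) (a : A) :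
    Measurable fun y => g θ (a, y) :=
  (hg.measurable θ).comp measurable_prodMk_left

theorem memLp (hg : E.IsLogLikelihood g b) (θ : Θ) (a : A) :
    MemLp (fun y => g θ (a, y)) 2 (E.trueLaw a) :=
  (hg.memLp_bound a).mono (hg.measurable_section θ a).aestronglyMeasurable
    (ae_of_all _ fun y => (hg.abs_le_bound θ a y).trans (le_abs_self _))

theorem modelLaw_eq_withDensity (hE : E.Standing) (hg : E.IsLogLikelihood g b) (θ : Θ) (a : A) :
    E.modelLaw θ a
      = (E.trueLaw a).withDensity fun y => ENNReal.ofReal (Real.exp (g θ (a, y))) := by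
  rw [trueLaw, ← withDensity_mul _ (hE.measurable_q a).coe_nnreal_ennreal
    (hg.measurable_section θ a).exp.ennreal_ofReal, modelLaw]
  refine withDensity_congr_ae ?_
  filter_upwards [hg.qModel_eq] with y hy
  rw [Pi.mul_apply, ← ENNReal.ofReal_coe_nnreal, hy a θ, ENNReal.ofReal_mul NNReal.zero_le_coe,
    ENNReal.ofReal_coe_nnreal]

theorem trueLaw_eq_withDensity (hE : E.Standing) (hg : E.IsLogLikelihood g b) (θ : Θ) (a : A) :
    E.trueLaw a
      = (E.modelLaw θ a).withDensity fun y => ENNReal.ofReal (Real.exp (-g θ (a, y))) := by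
  have hm := hg.measurable_section θ a
  have hm' : Measurable fun y => -g θ (a, y) := hm.neg
  rw [hg.modelLaw_eq_withDensity hE, ← withDensity_mul _ hm.exp.ennreal_ofReal
    hm'.exp.ennreal_ofReal]
  have : ((fun y => ENNReal.ofReal (Real.exp (g θ (a, y))))
      * fun y => ENNReal.ofReal (Real.exp (-g θ (a, y)))) = 1 := by
    ext y
    rw [Pi.mul_apply, ← ENNReal.ofReal_mul (Real.exp_pos _).le, ← Real.exp_add]
    simp
  rw [this, withDensity_one]

theorem U_eq_integral (hE : E.Standing) (hg : E.IsLogLikelihood g b) (a : A) (θ : Θ) :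
    E.U a θ = ∫ y, Real.exp (g θ (a, y)) * E.payoff a y ∂E.trueLaw a := by
  rw [U, hg.modelLaw_eq_withDensity hE,
    integral_withDensity_eq_integral_toReal_smul
      (hg.measurable_section θ a).exp.ennreal_ofReal (ae_of_all _ fun _ => ENNReal.ofReal_lt_top)]
  simp only [ENNReal.toReal_ofReal (Real.exp_pos _).le, smul_eq_mul]

theorem continuous_U [FirstCountableTopology Θ] (hE : E.Standing) (hg : E.IsLogLikelihood g b)
    (a : A) : Continuous (E.U a) := by
  have h : E.U a = fun θ => ∫ y, Real.exp (g θ (a, y)) * E.payoff a y ∂E.trueLaw a :=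
    funext fun θ => hg.U_eq_integral hE a θ
  rw [h]
  refine continuous_of_dominated (bound := fun y => ‖E.payoff a y * Real.exp (b y)‖) (fun θ => ?_)
    (fun θ => ae_of_all _ fun y => ?_) (hg.integrable_payoff a).norm (ae_of_all _ fun y => ?_)
  · exact ((hg.measurable_section θ a).exp.aemeasurable.mul ((hE.aemeasurable_payoff a).mono_ac
      (withDensity_absolutelyContinuous _ _))).aestronglyMeasurable
  · rw [norm_mul, norm_mul, mul_comm, Real.norm_of_nonneg (Real.exp_pos _).le,
      Real.norm_of_nonneg (Real.exp_pos _).le]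
    gcongr
    exact (le_abs_self _).trans (hg.abs_le_bound θ a y)
  · exact (hg.continuous (a, y)).rexp.mul continuous_const

/-- The two laws have mutual densities `exp (± g)`, so the log-likelihood ratio is `-g`, which is
integrable. Finiteness of the divergence lets the minimization be carried out in `ℝ`. -/
theorem K_eq_ofReal_loss (hE : E.Standing) (hg : E.IsLogLikelihood g b) (θ : Θ) (a : A) :
    E.K θ a = ENNReal.ofReal (E.loss g θ a) ∧ 0 ≤ E.loss g θ a := by
  have := hE.isProbability_trueLaw a
  have := hE.isProbability_modelLaw θ a
  have hac : E.trueLaw a ≪ E.modelLaw θ a := by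
    rw [hg.trueLaw_eq_withDensity hE θ a]
    exact withDensity_absolutelyContinuous _ _
  have hrn : (E.trueLaw a).rnDeriv (E.modelLaw θ a) =ᵐ[E.modelLaw θ a]
      fun y => ENNReal.ofReal (Real.exp (-g θ (a, y))) := by
    conv_lhs => rw [hg.trueLaw_eq_withDensity hE θ a]
    exact Measure.rnDeriv_withDensity _ (hg.measurable_section θ a).neg.exp.ennreal_ofReal
  have hllr : llr (E.trueLaw a) (E.modelLaw θ a) =ᵐ[E.trueLaw a] fun y => -g θ (a, y) := by
    filter_upwards [hac.ae_le hrn] with y hy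
    rw [llr, hy, ENNReal.toReal_ofReal (Real.exp_pos _).le, Real.log_exp]
  have hint : Integrable (llr (E.trueLaw a) (E.modelLaw θ a)) (E.trueLaw a) :=
    (integrable_congr hllr).2 ((hg.memLp θ a).integrable one_le_two).neg
  -- The total-mass terms in `klDiv` cancel for two probability measures.
  have heq : ∫ y, llr (E.trueLaw a) (E.modelLaw θ a) y ∂E.trueLaw a
      + (E.modelLaw θ a).real Set.univ - (E.trueLaw a).real Set.univ = E.loss g θ a := by
    rw [integral_congr_ae hllr, integral_neg]
    simp [loss]
  have h1 := InformationTheory.klDiv_of_ac_of_integrable hac hint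
  have h2 := InformationTheory.integral_llr_add_sub_measure_univ_nonneg hac hint
  rw [heq] at h1 h2
  exact ⟨h1, h2⟩

theorem mem_klMinimizers_iff [Fintype A] (hE : E.Standing) (hg : E.IsLogLikelihood g b)
    {σ : A → ℝ} (hσ : ∀ a, 0 ≤ σ a) (θ : Θ) :
    θ ∈ E.klMinimizers σ ↔ ∀ θ', ∑ a, σ a * E.loss g θ a ≤ ∑ a, σ a * E.loss g θ' a := by
  have hsum : ∀ θ, ∑ a, ENNReal.ofReal (σ a) * E.K θ a
      = ENNReal.ofReal (∑ a, σ a * E.loss g θ a) := by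
    intro θ
    rw [ENNReal.ofReal_sum_of_nonneg fun a _ =>
      mul_nonneg (hσ a) (hg.K_eq_ofReal_loss hE θ a).2]
    refine Finset.sum_congr rfl fun a _ => ?_
    rw [(hg.K_eq_ofReal_loss hE θ a).1, ENNReal.ofReal_mul (hσ a)]
  have hnn : ∀ θ, 0 ≤ ∑ a, σ a * E.loss g θ a := fun θ =>
    Finset.sum_nonneg fun a _ => mul_nonneg (hσ a) (hg.K_eq_ofReal_loss hE θ a).2
  simp only [klMinimizers, Set.mem_ofPred_eq, hsum]
  exact forall_congr' fun θ' => ENNReal.ofReal_le_ofReal_iff (hnn θ')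

end IsLogLikelihood

end Environment

/-! ### Oscillation in the parameter. -/

section Modulus

variable {Θ X : Type*} [PseudoMetricSpace Θ] [TopologicalSpace.SeparableSpace Θ] [Nonempty Θ]

open TopologicalSpace in
/-- The oscillation of `θ ↦ g θ x` at scale `δ`, as a countable supremum. -/
def modulus (g : Θ → X → ℝ) (δ : ℝ) (x : X) : ℝ :=
  ⨆ p : ℕ × ℕ, if dist (denseSeq Θ p.1) (denseSeq Θ p.2) < δ then
    |g (denseSeq Θ p.1) x - g (denseSeq Θ p.2) x| else 0

variable {g : Θ → X → ℝ} {δ c : ℝ} {x : X}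

theorem modulus_nonneg : 0 ≤ modulus g δ x :=
  Real.iSup_nonneg fun p => by split_ifs <;> positivity

theorem modulus_le (hc : 0 ≤ c) (h : ∀ θ θ', dist θ θ' < δ → |g θ x - g θ' x| ≤ c) :
    modulus g δ x ≤ c :=
  ciSup_le fun p => by
    split_ifs with hp
    · exact h _ _ hp
    · exact hc

theorem measurable_modulus [MeasurableSpace X] (hg : ∀ θ, Measurable (g θ)) :
    Measurable (modulus g δ) := by
  refine Measurable.iSup fun p => ?_
  split_ifs
  · exact ((hg _).sub (hg _)).abs
  · exact measurable_const

/-- The inequality is a closed condition that holds at pairs from the dense sequence. Since `dist <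
δ` is an open condition, such pairs are dense in the set it defines. -/
theorem abs_sub_le_modulus (hx : Continuous fun θ => g θ x)
    (hbdd : ∀ θ, |g θ x| ≤ c) {θ θ' : Θ} (h : dist θ θ' < δ) :
    |g θ x - g θ' x| ≤ modulus g δ x := by
  have hB : BddAbove (Set.range fun p : ℕ × ℕ =>
      if dist (TopologicalSpace.denseSeq Θ p.1) (TopologicalSpace.denseSeq Θ p.2) < δ then
        |g (TopologicalSpace.denseSeq Θ p.1) x - g (TopologicalSpace.denseSeq Θ p.2) x|
      else 0) := by
    refine ⟨c + c, ?_⟩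
    rintro _ ⟨p, rfl⟩
    have h0 : 0 ≤ c := (abs_nonneg _).trans (hbdd θ)
    dsimp only
    split_ifs
    · exact (abs_sub _ _).trans (add_le_add (hbdd _) (hbdd _))
    · positivity
  have hdense : DenseRange (Prod.map (TopologicalSpace.denseSeq Θ) (TopologicalSpace.denseSeq Θ)) :=
    (TopologicalSpace.denseRange_denseSeq Θ).prodMap (TopologicalSpace.denseRange_denseSeq Θ)
  have hopen : IsOpen {p : Θ × Θ | dist p.1 p.2 < δ} :=
    isOpen_lt (continuous_fst.dist continuous_snd) continuous_const
  have hclosed : IsClosed {p : Θ × Θ | |g p.1 x - g p.2 x| ≤ modulus g δ x} :=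
    isClosed_le ((hx.comp continuous_fst).sub (hx.comp continuous_snd)).abs continuous_const
  have hsub : {p : Θ × Θ | dist p.1 p.2 < δ} ∩
      Set.range (Prod.map (TopologicalSpace.denseSeq Θ) (TopologicalSpace.denseSeq Θ))
        ⊆ {p : Θ × Θ | |g p.1 x - g p.2 x| ≤ modulus g δ x} := by
    rintro _ ⟨hp, p, rfl⟩
    exact (if_pos hp).symm.trans_le (le_ciSup hB p)
  exact hclosed.closure_subset_iff.2 hsub
    (hdense.open_subset_closure_inter hopen (show (θ, θ') ∈ _ from h))

theorem tendsto_modulus [CompactSpace Θ] (hx : Continuous fun θ => g θ x) :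
    Tendsto (fun k : ℕ => modulus g (1 / ((k : ℝ) + 1)) x) atTop (𝓝 0) := by
  rw [Metric.tendsto_atTop]
  intro ε hε
  obtain ⟨δ, hδ, hδε⟩ := Metric.uniformContinuous_iff.1
    (CompactSpace.uniformContinuous_of_continuous hx) (ε / 2) (by positivity)
  obtain ⟨N, hN⟩ := exists_nat_one_div_lt hδ
  refine ⟨N, fun n hn => ?_⟩
  rw [Real.dist_0_eq_abs, abs_of_nonneg modulus_nonneg]
  refine lt_of_le_of_lt (modulus_le (c := ε / 2) (by positivity) fun θ θ' h => ?_) (by linarith)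
  have hlt : dist θ θ' < δ := h.trans_le ((Nat.one_div_le_one_div hn).trans hN.le)
  exact (hδε hlt).le

end Modulus

namespace Environment.IsLogLikelihood

variable {A Θ Y : Type*} [MeasurableSpace Y] [MeasurableSpace A] [PseudoMetricSpace Θ]
  [CompactSpace Θ] [Nonempty Θ] {E : Environment A Θ Y} {g : Θ → A × Y → ℝ} {b : Y → ℝ}

theorem modulus_le_bound (hg : E.IsLogLikelihood g b) (δ : ℝ) (a : A) (y : Y) :
    modulus g δ (a, y) ≤ b y + b y :=
  modulus_le
    (add_nonneg ((abs_nonneg _).trans (hg.abs_le_bound (Classical.arbitrary Θ) a y))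
      ((abs_nonneg _).trans (hg.abs_le_bound (Classical.arbitrary Θ) a y)))
    fun θ θ' _ => (abs_sub _ _).trans (add_le_add (hg.abs_le_bound θ a y) (hg.abs_le_bound θ' a y))

theorem memLp_modulus (hg : E.IsLogLikelihood g b) (δ : ℝ) (a : A) :
    MemLp (fun y => modulus g δ (a, y)) 2 (E.trueLaw a) := by
  refine ((hg.memLp_bound a).add (hg.memLp_bound a)).mono
    ((measurable_modulus hg.measurable).comp measurable_prodMk_left).aestronglyMeasurable
    (ae_of_all _ fun y => ?_)
  rw [Real.norm_of_nonneg modulus_nonneg]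
  exact (hg.modulus_le_bound δ a y).trans (le_abs_self _)

theorem tendsto_integral_modulus (hE : E.Standing) (hg : E.IsLogLikelihood g b) (a : A) :
    Tendsto (fun k : ℕ => ∫ y, modulus g (1 / ((k : ℝ) + 1)) (a, y) ∂E.trueLaw a) atTop (𝓝 0) := by
  have := hE.isProbability_trueLaw a
  have hb := (hg.memLp_bound a).integrable one_le_two
  rw [← integral_zero Y ℝ (μ := E.trueLaw a)]
  refine tendsto_integral_of_dominated_convergence (fun y => b y + b y)
    (fun k => (hg.memLp_modulus _ a).aestronglyMeasurable) (hb.add hb)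
    (fun k => ae_of_all _ fun y => ?_) (ae_of_all _ fun y => tendsto_modulus (hg.continuous (a, y)))
  rw [Real.norm_of_nonneg modulus_nonneg]
  exact hg.modulus_le_bound _ a y

theorem abs_loss_sub_le (hE : E.Standing) (hg : E.IsLogLikelihood g b) {δ : ℝ} {θ θ' : Θ}
    (h : dist θ θ' < δ) (a : A) :
    |E.loss g θ a - E.loss g θ' a| ≤ ∫ y, modulus g δ (a, y) ∂E.trueLaw a := by
  have := hE.isProbability_trueLaw a
  have hi := (hg.memLp θ a).integrable one_le_two
  have hi' := (hg.memLp θ' a).integrable one_le_two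
  have : E.loss g θ a - E.loss g θ' a = -∫ y, (g θ (a, y) - g θ' (a, y)) ∂E.trueLaw a := by
    rw [integral_sub hi hi', loss, loss]; ring
  rw [this, abs_neg]
  refine (abs_integral_le_integral_abs).trans ?_
  exact integral_mono (hi.sub hi').abs ((hg.memLp_modulus δ a).integrable one_le_two) fun y =>
    abs_sub_le_modulus (hg.continuous (a, y)) (fun θ => hg.abs_le_bound θ a y) h

end Environment.IsLogLikelihood

/-! ### Beliefs as exponential tilts of the prior. -/

section Tilted

variable {Θ : Type*} [TopologicalSpace Θ] [CompactSpace Θ] [MeasurableSpace Θ] [BorelSpace Θ]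

theorem integrable_of_continuous_of_compactSpace (μ : Measure Θ) [IsFiniteMeasure μ] {f : Θ → ℝ}
    (hf : Continuous f) : Integrable f μ :=
  hf.integrable_of_hasCompactSupport (HasCompactSupport.of_compactSpace f)

/-- For `φ ∈ V` the normalizing integral is at least its part over `V'`, hence at least `exp (S φ +
c) * μ V'`. This bounds the density of the tilted measure on `V`. -/
theorem tilted_apply_le {μ : Measure Θ} [IsProbabilityMeasure μ] {S : Θ → ℝ} (hS : Continuous S)
    {V V' : Set Θ} (hV : MeasurableSet V) (hV' : MeasurableSet V') (hpos : 0 < μ.real V') {c : ℝ}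
    (h : ∀ φ ∈ V, ∀ φ' ∈ V', S φ ≤ S φ' - c) :
    μ.tilted S V ≤ ENNReal.ofReal (Real.exp (-c) / μ.real V') := by
  have hint : Integrable (fun φ => Real.exp (S φ)) μ :=
    integrable_of_continuous_of_compactSpace μ hS.rexp
  have hI : 0 < ∫ φ, Real.exp (S φ) ∂μ := integral_exp_pos hint
  have hbound : ∀ φ ∈ V, Real.exp (S φ) / ∫ φ, Real.exp (S φ) ∂μ ≤ Real.exp (-c) / μ.real V' := by
    intro φ hφ
    rw [div_le_div_iff₀ hI hpos]
    calc Real.exp (S φ) * μ.real V' = ∫ _ in V', Real.exp (S φ) ∂μ := by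
          rw [setIntegral_const, smul_eq_mul, mul_comm]
      _ ≤ ∫ φ' in V', Real.exp (-c) * Real.exp (S φ') ∂μ := by
          refine setIntegral_mono_on (integrableOn_const (measure_ne_top _ _))
            (hint.const_mul _).integrableOn hV' fun φ' hφ' => ?_
          rw [← Real.exp_add]
          exact Real.exp_le_exp.2 (by linarith [h φ hφ φ' hφ'])
      _ ≤ ∫ φ', Real.exp (-c) * Real.exp (S φ') ∂μ :=
          setIntegral_le_integral (hint.const_mul _) (ae_of_all _ fun φ' => by positivity)
      _ = Real.exp (-c) * ∫ φ', Real.exp (S φ') ∂μ := integral_const_mul _ _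
  rw [tilted_apply' _ _ hV]
  calc ∫⁻ φ in V, ENNReal.ofReal (Real.exp (S φ) / ∫ φ, Real.exp (S φ) ∂μ) ∂μ
      ≤ ∫⁻ _ in V, ENNReal.ofReal (Real.exp (-c) / μ.real V') ∂μ :=
        setLIntegral_mono measurable_const fun φ hφ => ENNReal.ofReal_le_ofReal (hbound φ hφ)
    _ = ENNReal.ofReal (Real.exp (-c) / μ.real V') * μ V := setLIntegral_const _ _
    _ ≤ ENNReal.ofReal (Real.exp (-c) / μ.real V') := mul_le_of_le_one_right' prob_le_one

end Tilted

namespace Environment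

variable {A Θ Y : Type*} [MeasurableSpace Y]

/-- The factor `q(y ∣ a)` does not depend on `θ`, so it cancels in Bayes' rule. -/
theorem bayesUpdate_eq_tilted [TopologicalSpace Θ] [CompactSpace Θ] [MeasurableSpace Θ]
    [BorelSpace Θ] (E : Environment A Θ Y) (μ : Measure Θ) [IsProbabilityMeasure μ] {a : A} {y : Y}
    {f : Θ → ℝ} (hf : Continuous f) (hq : E.q a y ≠ 0)
    (h : ∀ θ, (E.qModel θ a y : ℝ) = E.q a y * Real.exp (f θ)) :
    E.bayesUpdate μ a y = μ.tilted f := by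
  have hint : Integrable (fun θ => Real.exp (f θ)) μ :=
    integrable_of_continuous_of_compactSpace μ hf.rexp
  have hI : 0 < ∫ θ, Real.exp (f θ) ∂μ := integral_exp_pos hint
  have hq' : (0 : ℝ) < E.q a y := NNReal.coe_pos.2 (pos_iff_ne_zero.2 hq)
  have hcoe : (fun θ => (E.qModel θ a y : ℝ≥0∞))
      = fun θ => ENNReal.ofReal (E.q a y * Real.exp (f θ)) := by
    ext θ; rw [← h θ, ENNReal.ofReal_coe_nnreal]
  have hZ : ∫⁻ θ, ENNReal.ofReal (E.q a y * Real.exp (f θ)) ∂μ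
      = ENNReal.ofReal (E.q a y * ∫ θ, Real.exp (f θ) ∂μ) := by
    rw [← integral_const_mul, ofReal_integral_eq_lintegral_ofReal (hint.const_mul _)
      (ae_of_all _ fun θ => by positivity)]
  rw [bayesUpdate, hcoe, hZ, Measure.tilted, ← withDensity_smul _ (by fun_prop)]
  congr 1
  ext θ
  rw [Pi.smul_apply, smul_eq_mul, ← ENNReal.ofReal_inv_of_pos (by positivity),
    ← ENNReal.ofReal_mul (by positivity)]
  congr 1
  field_simp

theorem posterior_eq_tilted [TopologicalSpace Θ] [CompactSpace Θ] [MeasurableSpace Θ]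
    [BorelSpace Θ] (E : Environment A Θ Y) (prior : Measure Θ) [IsProbabilityMeasure prior]
    {g : Θ → A × Y → ℝ} (hg : ∀ x, Continuous fun θ => g θ x) {a : ℕ → A} {y : ℕ → Y}
    (hq : ∀ t, E.q (a t) (y t) ≠ 0)
    (h : ∀ t θ, (E.qModel θ (a t) (y t) : ℝ) = E.q (a t) (y t) * Real.exp (g θ (a t, y t)))
    (t : ℕ) :
    E.posterior prior a y t
      = prior.tilted fun θ => ∑ s ∈ Finset.range t, g θ (a s, y s) := by
  induction t with
  | zero =>
    simp only [Finset.range_zero, Finset.sum_empty]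
    exact (tilted_zero prior).symm
  | succ t ih =>
    have hint : Integrable (fun θ => Real.exp (∑ s ∈ Finset.range t, g θ (a s, y s))) prior :=
      integrable_of_continuous_of_compactSpace prior
        (continuous_finsetSum _ fun s _ => hg (a s, y s)).rexp
    have := isProbabilityMeasure_tilted hint
    rw [posterior, ih, bayesUpdate_eq_tilted E _ (hg (a t, y t)) (hq t) (h t), tilted_tilted hint]
    congr 1
    ext θ
    rw [Finset.sum_range_succ, Pi.add_apply]

/-- The expected payoffs under the belief that the log-likelihood ratios `g` assign to a
history. -/
def historyPayoff [MeasurableSpace Θ] (E : Environment A Θ Y) (prior : Measure Θ)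
    (g : Θ → A × Y → ℝ) (t : ℕ) (h : Fin t → (A → ℝ) × A × Y) (a : A) : ℝ :=
  ∫ θ, E.U a θ ∂prior.tilted fun θ => ∑ s, g θ (h s).2

namespace IsLogLikelihood

variable [MeasurableSpace A] [MetricSpace Θ] [CompactSpace Θ]
  {E : Environment A Θ Y} {g : Θ → A × Y → ℝ} {b : Y → ℝ}

/-- `g` is continuous in the parameter and measurable in the observation, hence jointly measurable.
This makes the choice probabilities measurable functions of the history. -/
theorem measurable_historyPayoff [MeasurableSpace Θ] [BorelSpace Θ] (hE : E.Standing)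
    (hg : E.IsLogLikelihood g b) (prior : Measure Θ) [IsProbabilityMeasure prior] (t : ℕ) :
    Measurable (E.historyPayoff prior g t) := by
  have hgm : Measurable fun p : (A × Y) × Θ => g p.2 p.1 :=
    (measurable_uncurry_of_continuous_of_measurable (u := fun θ x => g θ x)
      hg.continuous hg.measurable).comp measurable_swap
  have hS : Measurable fun p : (Fin t → (A → ℝ) × A × Y) × Θ => ∑ s, g p.2 (p.1 s).2 := by
    refine Finset.measurable_fun_sum _ fun s _ => ?_
    exact hgm.comp ((measurable_snd.comp ((measurable_pi_apply s).comp measurable_fst)).prodMk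
      measurable_snd)
  have hI : Measurable fun h : Fin t → (A → ℝ) × A × Y =>
      ∫ θ, Real.exp (∑ s, g θ (h s).2) ∂prior :=
    (hS.exp.stronglyMeasurable.integral_prod_right
      (f := fun (h : Fin t → (A → ℝ) × A × Y) θ => Real.exp (∑ s, g θ (h s).2))).measurable
  refine measurable_pi_lambda _ fun a => ?_
  have heq : (fun h => E.historyPayoff prior g t h a) = fun h => ∫ θ,
      (Real.exp (∑ s, g θ (h s).2) / ∫ θ, Real.exp (∑ s, g θ (h s).2) ∂prior) * E.U a θ ∂prior := by
    ext h
    rw [historyPayoff, integral_tilted]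
    simp only [smul_eq_mul]
  rw [heq]
  have hm : Measurable fun p : (Fin t → (A → ℝ) × A × Y) × Θ =>
      (Real.exp (∑ s, g p.2 (p.1 s).2) / ∫ θ, Real.exp (∑ s, g θ (p.1 s).2) ∂prior)
        * E.U a p.2 :=
    (hS.exp.div (hI.comp measurable_fst)).mul
      ((hg.continuous_U hE a).measurable.comp measurable_snd)
  exact (hm.stronglyMeasurable.integral_prod_right (f := fun (h : Fin t → (A → ℝ) × A × Y) θ =>
    (Real.exp (∑ s, g θ (h s).2) / ∫ θ, Real.exp (∑ s, g θ (h s).2) ∂prior) * E.U a θ)).measurable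

/-- If along the sequence `x` the averages of countably many functions converge to their
expectations under `σ`, then the average log-likelihood ratio converges locally uniformly. -/
theorem exists_nhds_abs_average_add_loss_le [Fintype A] [Nonempty Θ] (hE : E.Standing)
    (hg : E.IsLogLikelihood g b) {x : ℕ → A × Y} {σ : A → ℝ} (hσ : ∀ a, 0 ≤ σ a)
    (hx : ∀ n, Tendsto (fun t : ℕ => (t : ℝ)⁻¹ * ∑ s ∈ Finset.range t,
        g (TopologicalSpace.denseSeq Θ n) (x s)) atTop
      (𝓝 (∑ a, σ a * ∫ y, g (TopologicalSpace.denseSeq Θ n) (a, y) ∂E.trueLaw a)))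
    (hW : ∀ k : ℕ, Tendsto (fun t : ℕ => (t : ℝ)⁻¹ * ∑ s ∈ Finset.range t,
        modulus g (1 / ((k : ℝ) + 1)) (x s)) atTop
      (𝓝 (∑ a, σ a * ∫ y, modulus g (1 / ((k : ℝ) + 1)) (a, y) ∂E.trueLaw a)))
    (θ : Θ) {ε : ℝ} (hε : 0 < ε) :
    ∃ V : Set Θ, IsOpen V ∧ θ ∈ V ∧ ∀ᶠ t : ℕ in atTop, ∀ φ ∈ V,
      |(t : ℝ)⁻¹ * ∑ s ∈ Finset.range t, g φ (x s) + ∑ a, σ a * E.loss g θ a| ≤ ε := by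
  have hWlim : Tendsto (fun k : ℕ =>
      ∑ a, σ a * ∫ y, modulus g (1 / ((k : ℝ) + 1)) (a, y) ∂E.trueLaw a) atTop (𝓝 0) := by
    have := tendsto_finsetSum Finset.univ fun a _ =>
      (hg.tendsto_integral_modulus hE a).const_mul (σ a)
    simpa using this
  -- The error splits through a dense parameter `θn`: `ε / 4` for the loss from `θ` to `θn`, `ε / 4`
  -- for the strong law at `θn`, and `ε / 2` for the averages from `φ` to `θn`. The radius `δ / 2`
  -- below puts `φ` and `θn` within `δ` of each other.
  obtain ⟨k, hk⟩ := (hWlim.eventually_lt_const (show 0 < ε / 4 by positivity)).exists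
  set δ : ℝ := 1 / ((k : ℝ) + 1)
  have hδ : 0 < δ := by positivity
  obtain ⟨n, hn⟩ := (TopologicalSpace.denseRange_denseSeq Θ).exists_mem_open
    (Metric.isOpen_ball (x := θ) (ε := δ / 2)) ⟨θ, Metric.mem_ball_self (by positivity)⟩
  refine ⟨Metric.ball θ (δ / 2), Metric.isOpen_ball, Metric.mem_ball_self (by positivity), ?_⟩
  set θn := TopologicalSpace.denseSeq Θ n
  have h1 := (hx n).eventually (Metric.ball_mem_nhds _ (show 0 < ε / 4 by positivity))
  have h2 := (hW k).eventually_lt_const (show _ < ε / 2 by linarith)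
  filter_upwards [h1, h2] with t ht1 ht2 φ hφ
  rw [Real.dist_eq] at ht1
  rw [Metric.mem_ball] at hn hφ
  have hloss : |∑ a, σ a * E.loss g θ a - ∑ a, σ a * E.loss g θn a| ≤ ε / 4 := by
    rw [← Finset.sum_sub_distrib]
    refine (Finset.abs_sum_le_sum_abs _ _).trans (le_trans (Finset.sum_le_sum fun a _ => ?_) hk.le)
    rw [← mul_sub, abs_mul, abs_of_nonneg (hσ a)]
    exact mul_le_mul_of_nonneg_left
      (hg.abs_loss_sub_le hE (by rw [dist_comm]; linarith) a) (hσ a)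
  have hlossn : ∑ a, σ a * ∫ y, g θn (a, y) ∂E.trueLaw a = -∑ a, σ a * E.loss g θn a := by
    simp [loss]
  have havg : |(t : ℝ)⁻¹ * ∑ s ∈ Finset.range t, g φ (x s)
      - (t : ℝ)⁻¹ * ∑ s ∈ Finset.range t, g θn (x s)| ≤ ε / 2 := by
    rw [← mul_sub, ← Finset.sum_sub_distrib, abs_mul, abs_of_nonneg (by positivity)]
    refine le_trans (mul_le_mul_of_nonneg_left ?_ (by positivity)) ht2.le
    refine (Finset.abs_sum_le_sum_abs _ _).trans (Finset.sum_le_sum fun s _ => ?_)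
    refine abs_sub_le_modulus (hg.continuous (x s)) (fun θ => hg.abs_le_bound θ (x s).1 (x s).2) ?_
    linarith [dist_triangle_right φ θn θ]
  rw [hlossn] at ht1
  rw [abs_le] at *
  rw [abs_lt] at ht1
  constructor <;> linarith [ht1.1, ht1.2, hloss.1, hloss.2, havg.1, havg.2]

/-- The tilted beliefs put vanishing mass near a parameter that does not minimize the loss. -/
theorem exists_open_tendsto_tilted_zero [Fintype A] [MeasurableSpace Θ] [BorelSpace Θ]
    (hE : E.Standing) (hg : E.IsLogLikelihood g b) (prior : Measure Θ) [IsProbabilityMeasure prior]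
    [prior.IsOpenPosMeasure] {x : ℕ → A × Y} {σ : A → ℝ} (hσ : ∀ a, 0 ≤ σ a) [Nonempty Θ]
    (hx : ∀ n, Tendsto (fun t : ℕ => (t : ℝ)⁻¹ * ∑ s ∈ Finset.range t,
        g (TopologicalSpace.denseSeq Θ n) (x s)) atTop
      (𝓝 (∑ a, σ a * ∫ y, g (TopologicalSpace.denseSeq Θ n) (a, y) ∂E.trueLaw a)))
    (hW : ∀ k : ℕ, Tendsto (fun t : ℕ => (t : ℝ)⁻¹ * ∑ s ∈ Finset.range t,
        modulus g (1 / ((k : ℝ) + 1)) (x s)) atTop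
      (𝓝 (∑ a, σ a * ∫ y, modulus g (1 / ((k : ℝ) + 1)) (a, y) ∂E.trueLaw a)))
    {θ θ' : Θ} (hlt : ∑ a, σ a * E.loss g θ' a < ∑ a, σ a * E.loss g θ a) :
    ∃ V : Set Θ, IsOpen V ∧ θ ∈ V ∧ Tendsto (fun t : ℕ =>
      prior.tilted (fun φ => ∑ s ∈ Finset.range t, g φ (x s)) V) atTop (𝓝 0) := by
  -- The gap in loss is `4 ε`, and each of the two averages errs by at most `ε`; a margin of `ε` per
  -- period is more than what is left.
  set ε := (∑ a, σ a * E.loss g θ a - ∑ a, σ a * E.loss g θ' a) / 4 with hεdef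
  have hε : 0 < ε := by rw [hεdef]; linarith
  obtain ⟨V, hVo, hθV, hV⟩ := hg.exists_nhds_abs_average_add_loss_le hE hσ hx hW θ hε
  obtain ⟨V', hVo', hθV', hV'⟩ := hg.exists_nhds_abs_average_add_loss_le hE hσ hx hW θ' hε
  refine ⟨V, hVo, hθV, ?_⟩
  have hpos : 0 < prior.real V' :=
    ENNReal.toReal_pos (hVo'.measure_pos prior ⟨θ', hθV'⟩).ne' (measure_ne_top _ _)
  have hlim : Tendsto (fun t : ℕ =>
      ENNReal.ofReal (Real.exp (-((t : ℝ) * ε)) / prior.real V')) atTop (𝓝 0) := by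
    rw [← ENNReal.ofReal_zero]
    refine ENNReal.tendsto_ofReal ?_
    have : Tendsto (fun t : ℕ => Real.exp (-((t : ℝ) * ε))) atTop (𝓝 0) :=
      Real.tendsto_exp_neg_atTop_nhds_zero.comp
        (tendsto_natCast_atTop_atTop.atTop_mul_const hε)
    simpa using this.div_const (prior.real V')
  refine tendsto_of_tendsto_of_tendsto_of_le_of_le' tendsto_const_nhds hlim
    (Eventually.of_forall fun _ => bot_le) ?_
  filter_upwards [hV, hV', eventually_gt_atTop 0] with t ht ht' ht0
  have ht0' : (0 : ℝ) < t := by exact_mod_cast ht0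
  refine tilted_apply_le (continuous_finsetSum _ fun s _ => hg.continuous (x s))
    hVo.measurableSet hVo'.measurableSet hpos fun φ hφ φ' hφ' => ?_
  have h1 := (abs_le.1 (ht φ hφ)).2
  have h2 := (abs_le.1 (ht' φ' hφ')).1
  have h3 : (t : ℝ)⁻¹ * ∑ s ∈ Finset.range t, g φ (x s)
      ≤ (t : ℝ)⁻¹ * ∑ s ∈ Finset.range t, g φ' (x s) - ε := by linarith
  have h4 := mul_le_mul_of_nonneg_left h3 ht0'.le
  rwa [mul_sub, mul_inv_cancel_left₀ ht0'.ne', mul_inv_cancel_left₀ ht0'.ne'] at h4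

end IsLogLikelihood

end Environment

/-! ### Integration over the fibers of the action. -/

section Fibers

variable {A Ω : Type*} [Fintype A] {mΩ : MeasurableSpace Ω} {P : Measure Ω}

theorem integrable_of_integrableOn_fiber {X : Ω → A} {Z : Ω → ℝ}
    (hZ : ∀ a, IntegrableOn Z (X ⁻¹' {a}) P) : Integrable Z P := by
  have hU : ⋃ a, X ⁻¹' {a} = Set.univ := by ext ω; simp
  rw [← integrableOn_univ, ← hU]
  exact integrableOn_finite_iUnion.2 hZ

theorem setIntegral_eq_sum_fiber [MeasurableSpace A] [MeasurableSingletonClass A] {X : Ω → A}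
    (hX : Measurable X) {Z : Ω → ℝ} (hZ : Integrable Z P) {S : Set Ω} (hS : MeasurableSet S) :
    ∫ ω in S, Z ω ∂P = ∑ a, ∫ ω in S ∩ X ⁻¹' {a}, Z ω ∂P := by
  rw [← integral_iUnion_fintype (fun a => hS.inter (hX (measurableSet_singleton a)))
    (fun a a' haa' => ?_) (fun a => hZ.integrableOn)]
  · congr 2
    ext ω
    simp
  · refine Set.disjoint_left.2 fun ω h h' => haa' ?_
    exact h.2.symm.trans h'.2

end Fibers

/-! ### Strong law for the consequences. -/

namespace Environment

namespace IsLearningDynamics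

variable {A Θ Y : Type*} [MeasurableSpace Y] [MeasurableSpace A] [MeasurableSpace Θ]
  {E : Environment A Θ Y} {prior : Measure Θ} {shock : Measure (A → ℝ)}
  {Ω : Type*} {mΩ : MeasurableSpace Ω} {P : Measure Ω}
  {η : ℕ → Ω → A → ℝ} {act : ℕ → Ω → A} {y : ℕ → Ω → Y}

theorem measurable_history (hproc : E.IsLearningDynamics prior shock P η act y) (t : ℕ) :
    Measurable (history η act y t) :=
  measurable_pi_lambda _ fun s =>
    (hproc.measurable_shock s).prodMk ((hproc.measurable_act s).prodMk (hproc.measurable_y s))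

variable (η act y) in
/-- The information available when the consequence of period `t` is drawn. -/
def interim (t : ℕ) (ω : Ω) : (Fin t → (A → ℝ) × A × Y) × (A → ℝ) × A :=
  (history η act y t ω, η t ω, act t ω)

theorem measurable_interim (hproc : E.IsLearningDynamics prior shock P η act y) (t : ℕ) :
    Measurable (interim η act y t) :=
  (hproc.measurable_history t).prodMk ((hproc.measurable_shock t).prodMk (hproc.measurable_act t))

/-- With the next lemma this interlaces the two information structures. Actions are martingale
differences for the histories, consequences for the interim information. -/
theorem comap_interim_le_comap_history (t : ℕ) :
    MeasurableSpace.comap (interim η act y t) inferInstance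
      ≤ MeasurableSpace.comap (history η act y (t + 1)) inferInstance := by
  have hm : Measurable fun h : Fin (t + 1) → (A → ℝ) × A × Y =>
      ((fun s : Fin t => h s.castSucc, (h (Fin.last t)).1, (h (Fin.last t)).2.1) :
        (Fin t → (A → ℝ) × A × Y) × (A → ℝ) × A) := by fun_prop
  have h : interim η act y t = (fun h : Fin (t + 1) → (A → ℝ) × A × Y =>
      ((fun s : Fin t => h s.castSucc, (h (Fin.last t)).1, (h (Fin.last t)).2.1) :
        (Fin t → (A → ℝ) × A × Y) × (A → ℝ) × A)) ∘ history η act y (t + 1) := rfl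
  rw [h, ← MeasurableSpace.comap_comp]
  exact MeasurableSpace.comap_mono hm.comap_le

theorem comap_history_le_comap_interim (t : ℕ) :
    MeasurableSpace.comap (history η act y t) inferInstance
      ≤ MeasurableSpace.comap (interim η act y t) inferInstance := by
  have h : history η act y t = Prod.fst ∘ interim η act y t := rfl
  rw [h, ← MeasurableSpace.comap_comp]
  exact MeasurableSpace.comap_mono measurable_fst.comap_le

/-- The filtration generated by the histories. -/
def historyFiltration (hproc : E.IsLearningDynamics prior shock P η act y) : Filtration ℕ mΩ where
  seq t := MeasurableSpace.comap (history η act y t) inferInstance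
  mono' := monotone_nat_of_le_succ fun t =>
    (comap_history_le_comap_interim t).trans (comap_interim_le_comap_history t)
  le' t := (hproc.measurable_history t).comap_le

/-- The filtration generated by the histories together with the current shock and action. -/
def interimFiltration (hproc : E.IsLearningDynamics prior shock P η act y) : Filtration ℕ mΩ where
  seq t := MeasurableSpace.comap (interim η act y t) inferInstance
  mono' := monotone_nat_of_le_succ fun t =>
    (comap_interim_le_comap_history t).trans (comap_history_le_comap_interim (t + 1))
  le' t := (hproc.measurable_interim t).comap_le

theorem measurable_act_consequence (t : ℕ) :
    Measurable[MeasurableSpace.comap (history η act y (t + 1)) inferInstance]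
      fun ω => (act t ω, y t ω) := by
  have hm : Measurable fun h : Fin (t + 1) → (A → ℝ) × A × Y => (h (Fin.last t)).2 := by fun_prop
  exact hm.comp (comap_measurable (history η act y (t + 1)))

variable [MeasurableSingletonClass A] [IsProbabilityMeasure P]

/-- Where the action is `a`, the conditional law of the consequence is the constant `Q(· ∣ a)`, so
integrating it over the event gives a product. -/
theorem map_consequence_restrict (hE : ∀ a, IsProbabilityMeasure (E.trueLaw a))
    (hproc : E.IsLearningDynamics prior shock P η act y) {t : ℕ} {S : Set Ω}
    (hS : MeasurableSet[hproc.interimFiltration t] S) (a : A) :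
    (P.restrict (S ∩ act t ⁻¹' {a})).map (y t) = P (S ∩ act t ⁻¹' {a}) • E.trueLaw a := by
  have hSa : MeasurableSet[hproc.interimFiltration t] (S ∩ act t ⁻¹' {a}) := by
    refine hS.inter ?_
    have hm : Measurable[hproc.interimFiltration t] (act t) :=
      (measurable_snd.comp measurable_snd).comp (comap_measurable (interim η act y t))
    exact hm (measurableSet_singleton a)
  have hle := hproc.interimFiltration.le t
  ext B hB
  rw [Measure.map_apply (hproc.measurable_y t) hB,
    Measure.restrict_apply (hproc.measurable_y t hB), Measure.smul_apply, smul_eq_mul]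
  have h1 : ∫ ω in S ∩ act t ⁻¹' {a}, (P⟦y t ⁻¹' B | hproc.interimFiltration t⟧) ω ∂P
      = P.real (y t ⁻¹' B ∩ (S ∩ act t ⁻¹' {a})) := by
    rw [setIntegral_condExp hle ((integrable_const 1).indicator (hproc.measurable_y t hB)) hSa,
      integral_indicator (hproc.measurable_y t hB), setIntegral_one_eq_measureReal,
      measureReal_restrict_apply (hproc.measurable_y t hB)]
  have h2 : ∫ ω in S ∩ act t ⁻¹' {a}, (P⟦y t ⁻¹' B | hproc.interimFiltration t⟧) ω ∂P
      = P.real (S ∩ act t ⁻¹' {a}) * (E.trueLaw a).real B := by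
    rw [← smul_eq_mul, ← setIntegral_const]
    refine setIntegral_congr_ae (hle _ hSa) ?_
    filter_upwards [hproc.consequence_law t B hB] with ω hω hmem
    rw [← show act t ω = a from hmem.2]
    exact hω
  rw [h1] at h2
  simp only [measureReal_def, ← ENNReal.toReal_mul] at h2
  exact (ENNReal.toReal_eq_toReal_iff' (measure_ne_top _ _)
    (ENNReal.mul_ne_top (measure_ne_top _ _) (measure_ne_top _ _))).1 h2

theorem ae_of_ae_trueLaw [Countable A] (hE : ∀ a, IsProbabilityMeasure (E.trueLaw a))
    (hproc : E.IsLearningDynamics prior shock P η act y) {p : A → Y → Prop}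
    (hp : ∀ a, ∀ᵐ z ∂E.trueLaw a, p a z) (t : ℕ) : ∀ᵐ ω ∂P, p (act t ω) (y t ω) := by
  have h : ∀ a, ∀ᵐ ω ∂P, ω ∈ act t ⁻¹' {a} → p a (y t ω) := by
    intro a
    have hmap := hproc.map_consequence_restrict hE (t := t) MeasurableSet.univ a
    rw [Set.univ_inter] at hmap
    rw [← ae_restrict_iff' (hproc.measurable_act t (measurableSet_singleton a))]
    refine ae_of_ae_map (hproc.measurable_y t).aemeasurable (p := p a) ?_
    rw [hmap]
    exact Measure.ae_smul_measure (hp a) _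
  filter_upwards [ae_all_iff.2 h] with ω hω using hω _ rfl

variable [Fintype A]

theorem integrable_consequence (hE : ∀ a, IsProbabilityMeasure (E.trueLaw a))
    (hproc : E.IsLearningDynamics prior shock P η act y) {f : A × Y → ℝ}
    (hfi : ∀ a, Integrable (fun z => f (a, z)) (E.trueLaw a)) (t : ℕ) :
    Integrable (fun ω => f (act t ω, y t ω)) P := by
  refine integrable_of_integrableOn_fiber (X := act t) fun a => ?_
  have hmap := hproc.map_consequence_restrict hE (t := t) MeasurableSet.univ a
  rw [Set.univ_inter] at hmap
  have h : Integrable (fun ω => f (a, y t ω)) (P.restrict (act t ⁻¹' {a})) := by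
    refine Integrable.comp_measurable (f := y t) (g := fun z => f (a, z)) ?_ (hproc.measurable_y t)
    rw [hmap]
    exact (hfi a).smul_measure (measure_ne_top _ _)
  refine IntegrableOn.congr_fun h (fun ω hω => ?_)
    (hproc.measurable_act t (measurableSet_singleton a))
  rw [show act t ω = a from hω]

theorem setIntegral_consequence (hE : ∀ a, IsProbabilityMeasure (E.trueLaw a))
    (hproc : E.IsLearningDynamics prior shock P η act y) {f : A × Y → ℝ}
    (hfi : ∀ a, Integrable (fun z => f (a, z)) (E.trueLaw a)) {t : ℕ} {S : Set Ω}
    (hS : MeasurableSet[hproc.interimFiltration t] S) :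
    ∫ ω in S, f (act t ω, y t ω) ∂P
      = ∑ a, P.real (S ∩ act t ⁻¹' {a}) * ∫ z, f (a, z) ∂E.trueLaw a := by
  have hS' := hproc.interimFiltration.le t S hS
  rw [setIntegral_eq_sum_fiber (hproc.measurable_act t)
    (hproc.integrable_consequence hE hfi t) hS']
  refine Finset.sum_congr rfl fun a _ => ?_
  have hSa := hS'.inter (hproc.measurable_act t (measurableSet_singleton a))
  have hmap := hproc.map_consequence_restrict hE hS a
  have h1 : ∫ ω in S ∩ act t ⁻¹' {a}, f (act t ω, y t ω) ∂P
      = ∫ ω in S ∩ act t ⁻¹' {a}, f (a, y t ω) ∂P :=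
    setIntegral_congr_fun hSa fun ω hω => by
      rw [show act t ω = a from hω.2]
  rw [h1, ← integral_map (f := fun z => f (a, z)) (hproc.measurable_y t).aemeasurable, hmap,
    integral_smul_measure, smul_eq_mul, measureReal_def]
  rw [hmap]
  exact (hfi a).aestronglyMeasurable.smul_measure _

/-- The strong law of large numbers for functions of the current action and consequence. -/
theorem ae_tendsto_average_sub (hE : ∀ a, IsProbabilityMeasure (E.trueLaw a))
    (hproc : E.IsLearningDynamics prior shock P η act y) {f : A × Y → ℝ} (hf : Measurable f)
    (hf2 : ∀ a, MemLp (fun z => f (a, z)) 2 (E.trueLaw a)) :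
    ∀ᵐ ω ∂P, Tendsto (fun t : ℕ => (t : ℝ)⁻¹ * ∑ s ∈ Finset.range t,
      (f (act s ω, y s ω) - ∫ z, f (act s ω, z) ∂E.trueLaw (act s ω))) atTop (𝓝 0) := by
  -- Centering under `Q(· ∣ a)` for each action separately yields martingale differences, with
  -- second moments bounded by the sum of the variances over the finitely many actions.
  set f₀ : A × Y → ℝ := fun x => f x - ∫ z, f (x.1, z) ∂E.trueLaw x.1
  have hf₀ : Measurable f₀ := by
    have hF : Measurable fun a : A => ∫ z, f (a, z) ∂E.trueLaw a := measurable_of_countable _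
    exact hf.sub (hF.comp measurable_fst)
  have hf₀2 : ∀ a, MemLp (fun z => f₀ (a, z)) 2 (E.trueLaw a) := fun a =>
    (hf2 a).sub (memLp_const (∫ z, f (a, z) ∂E.trueLaw a))
  have hf₀i : ∀ a, Integrable (fun z => f₀ (a, z)) (E.trueLaw a) := fun a =>
    (hf₀2 a).integrable one_le_two
  have hf₀sq : ∀ a, Integrable (fun z => f₀ (a, z) ^ 2) (E.trueLaw a) := fun a =>
    (hf₀2 a).integrable_sq
  have hzero : ∀ a, ∫ z, f₀ (a, z) ∂E.trueLaw a = 0 := by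
    intro a
    simp only [f₀]
    rw [integral_sub ((hf2 a).integrable one_le_two) (integrable_const _)]
    simp
  have hmeas : ∀ t, Measurable fun ω => f₀ (act t ω, y t ω) := fun t =>
    hf₀.comp ((hproc.measurable_act t).prodMk (hproc.measurable_y t))
  refine ae_tendsto_average_zero_of_martingale_difference hproc.interimFiltration
    (D := fun t ω => f₀ (act t ω, y t ω)) (C := ∑ a, ∫ z, f₀ (a, z) ^ 2 ∂E.trueLaw a)
    (fun t => ?_) (fun t => ?_) (fun t S hS => ?_) (fun t => ?_)
  · have hm := (measurable_act_consequence (η := η) (act := act) (y := y) t).mono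
      (comap_history_le_comap_interim (t + 1)) le_rfl
    exact (hf₀.comp hm).stronglyMeasurable
  · exact (memLp_two_iff_integrable_sq (hmeas t).aestronglyMeasurable).2
      (hproc.integrable_consequence hE (f := fun x => f₀ x ^ 2) hf₀sq t)
  · rw [hproc.setIntegral_consequence hE hf₀i hS]
    simp [hzero]
  · rw [← setIntegral_univ, hproc.setIntegral_consequence hE (f := fun x => f₀ x ^ 2) hf₀sq
      MeasurableSet.univ]
    exact Finset.sum_le_sum fun a _ => mul_le_of_le_one_left
      (integral_nonneg fun z => sq_nonneg _) measureReal_le_one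

end IsLearningDynamics

end Environment

theorem measurable_choiceProb_comp {A H : Type*} [Fintype A] [MeasurableSpace H]
    {shock : Measure (A → ℝ)} [IsProbabilityMeasure shock] (hac : shock ≪ volume) {u : H → A → ℝ}
    (hu : Measurable u) (a : A) : Measurable fun h => choiceProb shock (u h) a :=
  (measurable_pi_apply a).comp ((continuous_choiceProb hac).measurable.comp hu)

theorem choiceProb_nonneg {A : Type*} {shock : Measure (A → ℝ)} (u : A → ℝ) (a : A) :
    0 ≤ choiceProb shock u a :=
  measureReal_nonneg

theorem choiceProb_le_one {A : Type*} {shock : Measure (A → ℝ)} [IsProbabilityMeasure shock]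
    (u : A → ℝ) (a : A) : choiceProb shock u a ≤ 1 :=
  measureReal_le_one

/-- If choices have frequencies close on average to `c`, which converges to `σ`, then averages
along the choices converge to expectations under `σ`. -/
theorem tendsto_average_of_tendsto_frequency {A X : Type*} [Fintype A] {x : ℕ → A} {c : ℕ → A → ℝ}
    {σ : A → ℝ} (hfreq : ∀ a, Tendsto (fun t : ℕ => (t : ℝ)⁻¹ * ∑ s ∈ Finset.range t,
      (Set.indicator {a} (fun _ => (1 : ℝ)) (x s) - c s a)) atTop (𝓝 0))
    (hc : Tendsto c atTop (𝓝 σ)) {z : ℕ → X} {f : A × X → ℝ} {F : A → ℝ}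
    (hf : Tendsto (fun t : ℕ => (t : ℝ)⁻¹ * ∑ s ∈ Finset.range t,
      (f (x s, z s) - F (x s))) atTop (𝓝 0)) :
    Tendsto (fun t : ℕ => (t : ℝ)⁻¹ * ∑ s ∈ Finset.range t, f (x s, z s)) atTop
      (𝓝 (∑ a, σ a * F a)) := by
  have hfr : ∀ a, Tendsto (fun t : ℕ => (t : ℝ)⁻¹ * ∑ s ∈ Finset.range t,
      Set.indicator {a} (fun _ => (1 : ℝ)) (x s)) atTop (𝓝 (σ a)) := by
    intro a
    have h := (hfreq a).add ((tendsto_pi_nhds.1 hc a).cesaro)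
    rw [zero_add] at h
    refine h.congr fun t => ?_
    rw [Finset.sum_sub_distrib]
    ring
  have h := hf.add (tendsto_finsetSum Finset.univ fun a _ => (hfr a).mul_const (F a))
  rw [zero_add] at h
  refine h.congr fun t => ?_
  -- Averages of `F (x s)` are thus the values of `F` weighted by empirical frequencies.
  have hF : ∀ s, F (x s) = ∑ a, Set.indicator {a} (fun _ => (1 : ℝ)) (x s) * F a := by
    classical
    intro s
    simp [Set.indicator_apply]
  have hsum : ∑ s ∈ Finset.range t, F (x s)
      = ∑ a, (∑ s ∈ Finset.range t, Set.indicator {a} (fun _ => (1 : ℝ)) (x s)) * F a := by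
    rw [Finset.sum_congr rfl fun s _ => hF s, Finset.sum_comm]
    simp only [Finset.sum_mul]
  have hsum' : ∑ a, (t : ℝ)⁻¹ * (∑ s ∈ Finset.range t,
      Set.indicator {a} (fun _ => (1 : ℝ)) (x s)) * F a
        = (t : ℝ)⁻¹ * ∑ s ∈ Finset.range t, F (x s) := by
    rw [hsum, Finset.mul_sum]
    simp only [mul_assoc]
  rw [hsum', Finset.sum_sub_distrib]
  ring

/-! ### Strong law for the action frequencies. -/

namespace Environment

variable {A Θ Y : Type*} [Fintype A] [MeasurableSpace Y] [MeasurableSpace A] [MeasurableSpace Θ]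
  {E : Environment A Θ Y} {prior : Measure Θ} {shock : Measure (A → ℝ)}
  {Ω : Type*} {mΩ : MeasurableSpace Ω} {P : Measure Ω} [IsProbabilityMeasure P] {η : ℕ → Ω → A → ℝ} {act : ℕ → Ω → A} {y : ℕ → Ω → Y}

namespace IsLearningDynamics

/-- The shock is independent of the history, so their joint law is a product and Tonelli's theorem
applies. -/
theorem measureReal_history_choiceRegion [IsProbabilityMeasure shock] (hac : shock ≪ volume)
    (hproc : E.IsLearningDynamics prior shock P η act y) {t : ℕ}
    {u : (Fin t → (A → ℝ) × A × Y) → A → ℝ} (hu : Measurable u)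
    {B : Set (Fin t → (A → ℝ) × A × Y)} (hB : MeasurableSet B) (a : A) :
    P.real {ω | history η act y t ω ∈ B ∧ η t ω ∈ choiceRegion (u (history η act y t ω)) a}
      = ∫ ω in history η act y t ⁻¹' B, choiceProb shock (u (history η act y t ω)) a ∂P := by
  have hhist := hproc.measurable_history t
  have hη := hproc.measurable_shock t
  have hc := measurable_choiceProb_comp hac hu a
  set R : Set ((Fin t → (A → ℝ) × A × Y) × (A → ℝ)) :=
    {p | p.1 ∈ B ∧ p.2 ∈ choiceRegion (u p.1) a} with hRdef
  have hR : MeasurableSet R := by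
    have hu' : ∀ b, Measurable fun p : (Fin t → (A → ℝ) × A × Y) × (A → ℝ) => u p.1 b + p.2 b :=
      fun b => ((measurable_pi_apply b).comp (hu.comp measurable_fst)).add
        ((measurable_pi_apply b).comp measurable_snd)
    have h2 : MeasurableSet {p : (Fin t → (A → ℝ) × A × Y) × (A → ℝ) |
        ∀ b, u p.1 b + p.2 b ≤ u p.1 a + p.2 a} := by
      simp only [Set.ofPred_forall]
      exact MeasurableSet.iInter fun b => measurableSet_le (hu' b) (hu' a)
    exact (measurable_fst hB).inter h2
  have hindep := (hproc.shock_indep t).symm.map_prod_eq_prod_map_map hhist.aemeasurable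
    hη.aemeasurable
  rw [hproc.shock_law t] at hindep
  have hmeas : P {ω | history η act y t ω ∈ B ∧ η t ω ∈ choiceRegion (u (history η act y t ω)) a}
      = ∫⁻ ω in history η act y t ⁻¹' B,
          ENNReal.ofReal (choiceProb shock (u (history η act y t ω)) a) ∂P := by
    calc P {ω | history η act y t ω ∈ B ∧ η t ω ∈ choiceRegion (u (history η act y t ω)) a}
        = P.map (fun ω => (history η act y t ω, η t ω)) R :=
          (Measure.map_apply (hhist.prodMk hη) hR).symm
      _ = ∫⁻ h, shock (Prod.mk h ⁻¹' R) ∂P.map (history η act y t) := by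
          rw [hindep, Measure.prod_apply hR]
      _ = ∫⁻ h, B.indicator (fun h => ENNReal.ofReal (choiceProb shock (u h) a)) h
            ∂P.map (history η act y t) := by
          refine lintegral_congr fun h => ?_
          by_cases hh : h ∈ B
          · rw [Set.indicator_of_mem hh, choiceProb, ofReal_measureReal]
            congr 1
            ext e
            simp [hRdef, hh]
          · rw [Set.indicator_of_notMem hh]
            have : Prod.mk h ⁻¹' R = ∅ := by
              ext e
              simp [hRdef, hh]
            rw [this, measure_empty]
      _ = ∫⁻ ω in history η act y t ⁻¹' B,
            ENNReal.ofReal (choiceProb shock (u (history η act y t ω)) a) ∂P := by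
          rw [lintegral_indicator hB, setLIntegral_map hB hc.ennreal_ofReal hhist]
  rw [measureReal_def, hmeas, integral_eq_lintegral_of_nonneg_ae
    (ae_of_all _ fun ω => choiceProb_nonneg _ _) (hc.comp hhist).aestronglyMeasurable]

/-- Given the history, the chosen action is distributed according to the choice probabilities. -/
theorem measureReal_history_act [Nonempty A] [MeasurableSingletonClass A]
    [IsProbabilityMeasure shock] (hac : shock ≪ volume)
    (hproc : E.IsLearningDynamics prior shock P η act y) {t : ℕ}
    {u : (Fin t → (A → ℝ) × A × Y) → A → ℝ} (hu : Measurable u)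
    (hopt : ∀ᵐ ω ∂P, η t ω ∈ choiceRegion (u (history η act y t ω)) (act t ω))
    {B : Set (Fin t → (A → ℝ) × A × Y)} (hB : MeasurableSet B) (a : A) :
    P.real (history η act y t ⁻¹' B ∩ act t ⁻¹' {a})
      = ∫ ω in history η act y t ⁻¹' B, choiceProb shock (u (history η act y t ω)) a ∂P := by
  have hhist := hproc.measurable_history t
  -- Optimality gives only an inequality, since ties may be broken in any way. Both sides sum over
  -- `a` to the probability of the event, which forces equality for each action.
  have hle : ∀ a ∈ Finset.univ, P.real (history η act y t ⁻¹' B ∩ act t ⁻¹' {a})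
      ≤ ∫ ω in history η act y t ⁻¹' B, choiceProb shock (u (history η act y t ω)) a ∂P := by
    intro a _
    rw [← hproc.measureReal_history_choiceRegion hac hu hB a]
    refine ENNReal.toReal_mono (measure_ne_top _ _) (measure_mono_ae ?_)
    filter_upwards [hopt] with ω hω hmem
    refine ⟨hmem.1, ?_⟩
    rwa [show act t ω = a from hmem.2] at hω
  have hint : ∀ a, Integrable (fun ω => choiceProb shock (u (history η act y t ω)) a)
      (P.restrict (history η act y t ⁻¹' B)) := by
    intro a
    refine Integrable.of_bound
      ((measurable_choiceProb_comp hac hu a).comp hhist).aestronglyMeasurable 1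
      (ae_of_all _ fun ω => ?_)
    rw [Real.norm_of_nonneg (choiceProb_nonneg _ _)]
    exact choiceProb_le_one _ _
  have hsum : ∑ a, P.real (history η act y t ⁻¹' B ∩ act t ⁻¹' {a})
      = ∑ a, ∫ ω in history η act y t ⁻¹' B, choiceProb shock (u (history η act y t ω)) a ∂P := by
    rw [← integral_finsetSum _ fun a _ => hint a]
    have h1 := setIntegral_eq_sum_fiber (P := P) (hproc.measurable_act t)
      (integrable_const (1 : ℝ)) (hhist hB)
    simp only [setIntegral_one_eq_measureReal] at h1
    rw [← h1]
    simp only [(choiceProb_mem_stdSimplex hac _).2, setIntegral_one_eq_measureReal]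
  exact (Finset.sum_eq_sum_iff_of_le hle).1 hsum a (Finset.mem_univ a)

/-- The strong law of large numbers for the frequencies of the actions. -/
theorem ae_tendsto_frequency_sub [Nonempty A] [MeasurableSingletonClass A]
    [IsProbabilityMeasure shock] (hac : shock ≪ volume)
    (hproc : E.IsLearningDynamics prior shock P η act y)
    {u : (t : ℕ) → (Fin t → (A → ℝ) × A × Y) → A → ℝ} (hu : ∀ t, Measurable (u t))
    (hopt : ∀ t, ∀ᵐ ω ∂P, η t ω ∈ choiceRegion (u t (history η act y t ω)) (act t ω)) (a : A) :
    ∀ᵐ ω ∂P, Tendsto (fun t : ℕ => (t : ℝ)⁻¹ * ∑ s ∈ Finset.range t,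
      (Set.indicator {a} (fun _ => (1 : ℝ)) (act s ω)
        - choiceProb shock (u s (history η act y s ω)) a)) atTop (𝓝 0) := by
  have hind : Measurable (Set.indicator {a} fun _ : A => (1 : ℝ)) :=
    measurable_const.indicator (measurableSet_singleton a)
  have hc : ∀ t, Measurable fun h => choiceProb shock (u t h) a := fun t =>
    measurable_choiceProb_comp hac (hu t) a
  have hmeas : ∀ t, Measurable[hproc.historyFiltration (t + 1)] fun ω =>
      Set.indicator {a} (fun _ => (1 : ℝ)) (act t ω)
        - choiceProb shock (u t (history η act y t ω)) a := by
    intro t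
    have h1 : Measurable[hproc.historyFiltration (t + 1)] (act t) :=
      measurable_fst.comp (measurable_act_consequence (η := η) (act := act) (y := y) t)
    have h2 : Measurable[hproc.historyFiltration (t + 1)] (history η act y t) :=
      (comap_measurable (history η act y t)).mono (hproc.historyFiltration.mono t.le_succ) le_rfl
    exact (hind.comp h1).sub ((hc t).comp h2)
  have hbound : ∀ t ω, |Set.indicator {a} (fun _ => (1 : ℝ)) (act t ω)
      - choiceProb shock (u t (history η act y t ω)) a| ≤ 1 := by
    intro t ω
    have h0 : 0 ≤ choiceProb shock (u t (history η act y t ω)) a := choiceProb_nonneg _ _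
    have h1 := choiceProb_le_one (shock := shock) (u t (history η act y t ω)) a
    rw [abs_le]
    by_cases h : act t ω ∈ ({a} : Set A)
    · rw [Set.indicator_of_mem h]
      constructor <;> linarith
    · rw [Set.indicator_of_notMem h]
      constructor <;> linarith
  have hL2 : ∀ t, MemLp (fun ω => Set.indicator {a} (fun _ => (1 : ℝ)) (act t ω)
      - choiceProb shock (u t (history η act y t ω)) a) 2 P := fun t =>
    MemLp.of_bound ((hmeas t).mono (hproc.historyFiltration.le (t + 1))
      le_rfl).aestronglyMeasurable 1 (ae_of_all _ (hbound t))
  refine ae_tendsto_average_zero_of_martingale_difference hproc.historyFiltration (C := 1)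
    (fun t => (hmeas t).stronglyMeasurable) hL2 (fun t S hS => ?_) (fun t => ?_)
  · obtain ⟨B, hB, rfl⟩ := hS
    have hS' := hproc.measurable_history t hB
    have hcint : Integrable (fun ω => choiceProb shock (u t (history η act y t ω)) a) P :=
      Integrable.of_bound ((hc t).comp (hproc.measurable_history t)).aestronglyMeasurable 1
        (ae_of_all _ fun ω => by
          rw [Real.norm_of_nonneg (choiceProb_nonneg _ _)]
          exact choiceProb_le_one _ _)
    have hiint : Integrable (fun ω => Set.indicator {a} (fun _ => (1 : ℝ)) (act t ω)) P :=
      (integrable_const (1 : ℝ)).indicator (hproc.measurable_act t (measurableSet_singleton a))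
    rw [integral_sub hiint.integrableOn hcint.integrableOn,
      ← hproc.measureReal_history_act hac (hu t) (hopt t) hB a, sub_eq_zero]
    have : (fun ω => Set.indicator {a} (fun _ => (1 : ℝ)) (act t ω))
        = (act t ⁻¹' {a}).indicator fun _ => (1 : ℝ) := rfl
    rw [this, setIntegral_indicator (hproc.measurable_act t (measurableSet_singleton a)),
      setIntegral_one_eq_measureReal]
  · calc ∫ ω, (Set.indicator {a} (fun _ => (1 : ℝ)) (act t ω)
          - choiceProb shock (u t (history η act y t ω)) a) ^ 2 ∂P ≤ ∫ _, (1 : ℝ) ∂P :=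
          integral_mono (hL2 t).integrable_sq (integrable_const 1) fun ω =>
            (sq_le_one_iff_abs_le_one _).2 (hbound t ω)
      _ = 1 := by simp

end IsLearningDynamics

/-! ### Passage to the limit in the beliefs. -/

section Compact

variable [MetricSpace Θ] [CompactSpace Θ] [BorelSpace Θ]
  {g : Θ → A × Y → ℝ} {b : Y → ℝ}

theorem continuous_intended [IsProbabilityMeasure shock] (hac : shock ≪ volume)
    (hE : E.Standing) (hg : E.IsLogLikelihood g b) :
    Continuous fun μ : ProbabilityMeasure Θ => E.intended shock (μ : Measure Θ) := by
  refine (continuous_choiceProb hac).comp (continuous_pi fun a => ?_)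
  exact ProbabilityMeasure.continuous_integral_continuousMap
    (⟨E.U a, hg.continuous_U hE a⟩ : C(Θ, ℝ))

/-- A consequence drawn from `Q(· ∣ a)` almost surely has `q(y ∣ a) ≠ 0`, so no period divides by
zero. -/
theorem IsLearningDynamics.ae_posterior_eq_tilted [MeasurableSingletonClass A]
    [IsProbabilityMeasure prior] (hE : E.Standing) (hg : E.IsLogLikelihood g b) (hproc : E.IsLearningDynamics prior shock P η act y) :
    ∀ᵐ ω ∂P, ∀ t, E.posterior prior (fun s => act s ω) (fun s => y s ω) t
      = prior.tilted fun θ => ∑ s ∈ Finset.range t, g θ (act s ω, y s ω) := by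
  have hp : ∀ a, ∀ᵐ z ∂E.trueLaw a, E.q a z ≠ 0 ∧
      ∀ θ, (E.qModel θ a z : ℝ) = E.q a z * Real.exp (g θ (a, z)) := by
    intro a
    rw [trueLaw, ae_withDensity_iff (hE.measurable_q a).coe_nnreal_ennreal]
    filter_upwards [hg.qModel_eq] with z hz hq
    exact ⟨by exact_mod_cast hq, hz a⟩
  filter_upwards [ae_all_iff.2 (hproc.ae_of_ae_trueLaw hE.isProbability_trueLaw hp)] with ω hω t
  exact E.posterior_eq_tilted prior hg.continuous (fun t => (hω t).1) (fun t => (hω t).2) t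

/-- A limit of intended mixed actions along which the beliefs put vanishing mass near parameters
that do not minimize the divergence is an equilibrium. -/
theorem isBerkNashIntended_of_tendsto [IsProbabilityMeasure shock] (hac : shock ≪ volume)
    (hE : E.Standing) (hg : E.IsLogLikelihood g b) {μ : ℕ → ProbabilityMeasure Θ} {σ : A → ℝ}
    (hσ : σ ∈ stdSimplex ℝ A)
    (hlim : Tendsto (fun t => E.intended shock (μ t : Measure Θ)) atTop (𝓝 σ))
    (hvanish : ∀ θ ∉ E.klMinimizers σ, ∃ V : Set Θ, IsOpen V ∧ θ ∈ V ∧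
      Tendsto (fun t => (μ t : Measure Θ) V) atTop (𝓝 0)) :
    E.IsBerkNashIntended shock σ := by
  -- A limit along a free ultrafilter replaces a convergent subsequence; the space of beliefs is
  -- compact.
  have hU : (hyperfilter ℕ : Filter ℕ) ≤ atTop := Nat.hyperfilter_le_atTop
  obtain ⟨μ', -, hμ'⟩ := isCompact_univ.ultrafilter_le_nhds ((hyperfilter ℕ).map μ) (by simp)
  have hconv : Tendsto μ (hyperfilter ℕ : Filter ℕ) (𝓝 μ') := hμ'
  refine ⟨hσ, μ', fun θ hθ => ?_, ?_⟩
  · by_contra hnot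
    obtain ⟨V, hVo, hθV, hV⟩ := hvanish θ hnot
    -- Portmanteau: the limit belief gives the open set no more mass than the limit inferior of the
    -- beliefs, which is `0`.
    have hle := ProbabilityMeasure.le_liminf_measure_open_of_tendsto hconv hVo
    rw [(hV.mono_left hU).liminf_eq] at hle
    exact Measure.notMem_support_iff_exists.2
      ⟨V, hVo.mem_nhds hθV, le_antisymm hle bot_le⟩ hθ
  · exact tendsto_nhds_unique (hlim.mono_left hU)
      (((continuous_intended hac hE hg).tendsto μ').comp hconv)

/-- Almost surely, every limit of the intended mixed actions is an equilibrium. -/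
theorem IsLearningDynamics.ae_isBerkNashIntended [Nonempty A] [MeasurableSingletonClass A]
    [Nonempty Θ] [IsProbabilityMeasure prior] [prior.IsOpenPosMeasure]
    [IsProbabilityMeasure shock] (hac : shock ≪ volume) (hE : E.Standing)
    (hg : E.IsLogLikelihood g b) (hproc : E.IsLearningDynamics prior shock P η act y) :
    ∀ᵐ ω ∂P, ∀ σ ∈ stdSimplex ℝ A,
      Tendsto
        (fun t => E.intended shock (E.posterior prior (fun s => act s ω) (fun s => y s ω) t))
        atTop (𝓝 σ) →
      E.IsBerkNashIntended shock σ := by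
  have hpost := hproc.ae_posterior_eq_tilted hE hg
  have hpayoff : ∀ t ω, (fun a => ∫ θ, E.U a θ
      ∂prior.tilted fun θ => ∑ s ∈ Finset.range t, g θ (act s ω, y s ω))
        = E.historyPayoff prior g t (history η act y t ω) := by
    intro t ω
    ext a
    simp only [historyPayoff, history, Finset.sum_range]
  have hopt : ∀ t, ∀ᵐ ω ∂P,
      η t ω ∈ choiceRegion (E.historyPayoff prior g t (history η act y t ω)) (act t ω) := by
    intro t
    filter_upwards [hproc.optimal t, hpost] with ω hω hω'
    rw [perturbedArgmax_iff, hω' t, hpayoff t ω] at hω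
    exact hω
  have hfreq := ae_all_iff.2 fun a => hproc.ae_tendsto_frequency_sub hac
    (hg.measurable_historyPayoff hE prior) hopt a
  have hlik := ae_all_iff.2 fun n : ℕ => hproc.ae_tendsto_average_sub hE.isProbability_trueLaw
    (hg.measurable (TopologicalSpace.denseSeq Θ n)) (hg.memLp (TopologicalSpace.denseSeq Θ n))
  have hmod := ae_all_iff.2 fun k : ℕ => hproc.ae_tendsto_average_sub hE.isProbability_trueLaw
    (measurable_modulus hg.measurable) (hg.memLp_modulus (1 / ((k : ℝ) + 1)))
  -- The almost sure event is fixed before `σ`, as none of the four statements mentions `σ`.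
  filter_upwards [hpost, hfreq, hlik, hmod] with ω hpost hfreq hlik hmod σ hσ hlim
  have hprob : ∀ t : ℕ, IsProbabilityMeasure
      (prior.tilted fun θ => ∑ s ∈ Finset.range t, g θ (act s ω, y s ω)) := fun t =>
    isProbabilityMeasure_tilted (integrable_of_continuous_of_compactSpace prior
      (continuous_finsetSum _ fun s _ => hg.continuous _).rexp)
  simp only [hpost] at hlim
  refine isBerkNashIntended_of_tendsto hac hE hg (μ := fun t => ⟨_, hprob t⟩) hσ hlim
    fun θ hθ => ?_
  rw [hg.mem_klMinimizers_iff hE hσ.1] at hθ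
  push Not at hθ
  obtain ⟨θ', hθ'⟩ := hθ
  simp only [intended_eq_choiceProb, hpayoff] at hlim
  exact hg.exists_open_tendsto_tilted_zero hE prior (x := fun s => (act s ω, y s ω)) hσ.1
    (fun n => tendsto_average_of_tendsto_frequency hfreq hlim (hlik n))
    (fun k => tendsto_average_of_tendsto_frequency hfreq hlim (hmod k)) hθ'

end Compact

end Environment

end BerkNash

end

theorem mainTheorem5 {A : Type*} [Fintype A] [Nonempty A] [MeasurableSpace A]
    [MeasurableSingletonClass A] {d m : ℕ}
    (Θ : Set (EuclideanSpace ℝ (Fin d))) (hΘ : IsCompact Θ) (hΘne : Θ.Nonempty)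
    (Y : Set (EuclideanSpace ℝ (Fin m))) (hY : MeasurableSet Y)
    (E : BerkNash.Environment A Θ Y) (hE : E.Standing)
    (prior : Measure Θ) [IsProbabilityMeasure prior] [prior.IsOpenPosMeasure]
    (shock : Measure (A → ℝ)) [IsProbabilityMeasure shock]
    (hshock : ∃ f : (A → ℝ) → ℝ≥0, Continuous f ∧
      shock = volume.withDensity fun e => (f e : ℝ≥0∞))
    {Ω : Type*} [MeasurableSpace Ω] (P : Measure Ω) [IsProbabilityMeasure P]
    (η : ℕ → Ω → A → ℝ) (act : ℕ → Ω → A) (y : ℕ → Ω → Y)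
    (hproc : E.IsLearningDynamics prior shock P η act y) :
    (∀ μ : ProbabilityMeasure Θ, E.intended shock (μ : Measure Θ) ∈ stdSimplex ℝ A) ∧
    Continuous (fun μ : ProbabilityMeasure Θ => E.intended shock (μ : Measure Θ)) ∧
    ∀ᵐ ω ∂P, ∀ σ ∈ stdSimplex ℝ A,
      Tendsto
        (fun t => E.intended shock (E.posterior prior (fun s => act s ω) (fun s => y s ω) t))
        atTop (𝓝 σ) →
      E.IsBerkNashIntended shock σ := by
  have : CompactSpace Θ := isCompact_iff_compactSpace.1 hΘ
  have : Nonempty Θ := hΘne.to_subtype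
  have hac : shock ≪ volume := by
    obtain ⟨f, -, rfl⟩ := hshock
    exact withDensity_absolutelyContinuous _ _
  obtain ⟨g, b, hg⟩ := BerkNash.Environment.exists_isLogLikelihood hE
  exact ⟨fun μ => BerkNash.choiceProb_mem_stdSimplex hac _,
    BerkNash.Environment.continuous_intended hac hE hg, hproc.ae_isBerkNashIntended hac hE hg⟩
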